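/- Let $h_n(x)=(-1)^n c_n e^{x^2/2}\frac{d^n}{dx^n}(e^{-x^2})$, $1/c_n=(n!)^{1/2}2^{n/2}\pi^{1/4}$, $n\ge 0$, be the Hermite functions, $\lambda_n=\sqrt{2n+1}$, and for $s\in\mathbb R$ let $\mathcal H^s(\mathbb R)$ be the space of tempered distributions $u=\sum_n c_n(u) h_n$, $c_n(u)=\langle u,h_n\rangle$, with norm $\|u\|_{\mathcal H^s}^2=\sum_n\lambda_n^{2s}|c_n(u)|^2<\infty$. Fix $\sigma>0$ and let $\mu$ be the Gaussian measure on $\mathcal H^{-\sigma}(\mathbb R)$ given by the distribution of $\sum_{n\ge0}\frac{\sqrt2}{\lambda_n}g_n h_n$, where the $g_n$ are independent standard complex Gaussians (density $\frac1\pi e^{-|z|^2}$). Fix $\chi\in C_0^\infty(-1,1)$ with $\chi=1$ on $[-\frac12,\frac12]$, and put $$\Pi_N u=\sum_{n=0}^N c_n(u)h_n,\qquad S_N u=\sum_{n\ge0}\chi\Big(\frac{2n+1}{2N+1}\Big)c_n(u)h_n,\qquad \alpha_N=\sum_{n=0}^N\frac{2}{\lambda_n^2}.$$ For every $\zeta\in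 C_0^\infty(\mathbb R)$ with $\zeta\ge0$, the functions $$G_N(u)=\zeta\big(\|\Pi_Nu\|_{L^2(\mathbb R)}^2-\alpha_N\big)\,e^{\frac14\int_{\mathbb R}|S_Nu(x)|^4\,dx}$$ converge in $\mu$-measure as $N\to\infty$ to a measurable limit $G=G_\zeta$, and the focusing Gibbs measure (for the cubic nonlinearity) is defined by $d\rho_\zeta=G_\zeta\,d\mu$. Then the topological supports in $\mathcal H^{-\sigma}(\mathbb R)$ satisfy $$\bigcup_{\zeta\in C_0^\infty(\mathbb R),\ \zeta\ge0}\operatorname{supp}\rho_\zeta=\operatorname{supp}\mu .$$ Moreover the focusing Gibbs measures are nontrivial: $\rho_\zeta\neq0$ for every such $\zeta$ that is not identically zero. -/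

import Mathlib

open MeasureTheory Filter Topology Set
open scoped SchwartzMap ContDiff ENNReal Nat

noncomputable section

namespace HarmonicNLS

/-! ## Hermite functions -/

/-- The normalisation constant `c_n`, with `1 / c_n = (n!)^{1/2} 2^{n/2} π^{1/4}`. -/
def hermiteConst (n : ℕ) : ℝ :=
  1 / (((n ! : ℕ) : ℝ) ^ (1 / 2 : ℝ) * (2 : ℝ) ^ ((n : ℝ) / 2) * Real.pi ^ (1 / 4 : ℝ))

/-- The Hermite function `h_n(x) = (-1)^n c_n e^{x²/2} (d/dx)^n e^{-x²}`. -/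
def hermiteFun (n : ℕ) (x : ℝ) : ℝ :=
  (-1) ^ n * hermiteConst n * Real.exp (x ^ 2 / 2) *
    iteratedDeriv n (fun y : ℝ => Real.exp (-y ^ 2)) x

/-- `λ_n = √(2n+1)`, so that `(-d²/dx² + x²) h_n = λ_n² h_n`. -/
def freq (n : ℕ) : ℝ := Real.sqrt (2 * n + 1)

theorem freq_pos (n : ℕ) : 0 < freq n := Real.sqrt_pos.2 (by positivity)

/-- Derivatives of a polynomial times `e^{-a x²}` are of the same form. -/
theorem iteratedDeriv_poly_gauss (a : ℝ) (n : ℕ) (p : Polynomial ℝ) :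
    ∃ q : Polynomial ℝ, iteratedDeriv n (fun y : ℝ => p.eval y * Real.exp (-a * y ^ 2)) =
      fun y => q.eval y * Real.exp (-a * y ^ 2) := by
  induction n generalizing p with
  | zero => exact ⟨p, by simp⟩
  | succ n ih =>
    have h : deriv (fun y : ℝ => p.eval y * Real.exp (-a * y ^ 2)) = fun y =>
        (Polynomial.derivative p - Polynomial.C (2 * a) * Polynomial.X * p).eval y *
          Real.exp (-a * y ^ 2) := by
      funext y
      have h1 : HasDerivAt (fun y : ℝ => Real.exp (-a * y ^ 2))
          (Real.exp (-a * y ^ 2) * (-a * (2 * y))) y := by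
        have h2 : HasDerivAt (fun y : ℝ => -a * y ^ 2) (-a * (2 * y)) y := by
          simpa using (hasDerivAt_pow 2 y).const_mul (-a)
        exact h2.exp
      rw [((p.hasDerivAt y).fun_mul h1).deriv]
      simp only [Polynomial.eval_sub, Polynomial.eval_mul, Polynomial.eval_C, Polynomial.eval_X]
      ring
    rw [iteratedDeriv_succ', h]
    exact ih _

/-- A polynomial times `e^{-x²/2}` is bounded. -/
theorem poly_gauss_bounded (p : Polynomial ℝ) :
    ∃ C : ℝ, ∀ x : ℝ, |p.eval x * Real.exp (-(1 / 2) * x ^ 2)| ≤ C := by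
  induction p using Polynomial.induction_on' with
  | add p q hp hq =>
    obtain ⟨C, hC⟩ := hp
    obtain ⟨D, hD⟩ := hq
    refine ⟨C + D, fun x => ?_⟩
    rw [Polynomial.eval_add, add_mul]
    exact (abs_add_le _ _).trans (add_le_add (hC x) (hD x))
  | monomial n a =>
    refine ⟨|a| * ((2 * n) ^ n + 1) * 1 + |a| * (2 ^ n * n !), fun x => ?_⟩
    rw [Polynomial.eval_monomial, abs_mul, abs_mul, abs_pow, Real.abs_exp]
    have hx : (0 : ℝ) ≤ x ^ 2 / 2 := by positivity
    have h1 : (x ^ 2 / 2) ^ n / (n ! : ℝ) ≤ Real.exp (x ^ 2 / 2) :=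
      Real.pow_div_factorial_le_exp _ hx n
    have hn : (0 : ℝ) < n ! := by positivity
    have hE : Real.exp (-(1 / 2) * x ^ 2) * Real.exp (x ^ 2 / 2) = 1 := by
      rw [← Real.exp_add]; ring_nf; simp
    have hpos := Real.exp_pos (-(1 / 2) * x ^ 2)
    have hle1 : Real.exp (-(1 / 2) * x ^ 2) ≤ 1 := by
      rw [Real.exp_le_one_iff]; nlinarith [sq_nonneg x]
    have h2 : (x ^ 2) ^ n * Real.exp (-(1 / 2) * x ^ 2) ≤ 2 ^ n * n ! := by
      rw [div_pow, div_div, div_le_iff₀ (by positivity)] at h1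
      calc (x ^ 2) ^ n * Real.exp (-(1 / 2) * x ^ 2)
          ≤ (Real.exp (x ^ 2 / 2) * (2 ^ n * n !)) * Real.exp (-(1 / 2) * x ^ 2) := by gcongr
        _ = (2 ^ n * n !) * (Real.exp (-(1 / 2) * x ^ 2) * Real.exp (x ^ 2 / 2)) := by ring
        _ = _ := by rw [hE, mul_one]
    have h3 : |x| ^ n ≤ 1 + (x ^ 2) ^ n := by
      rw [← sq_abs x, ← pow_mul, mul_comm 2 n, pow_mul]
      nlinarith [sq_nonneg (|x| ^ n - 1), sq_nonneg (|x| ^ n)]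
    have h4 : |x| ^ n * Real.exp (-(1 / 2) * x ^ 2) ≤ 1 + 2 ^ n * n ! := by
      calc |x| ^ n * Real.exp (-(1 / 2) * x ^ 2)
          ≤ (1 + (x ^ 2) ^ n) * Real.exp (-(1 / 2) * x ^ 2) := by gcongr
        _ ≤ _ := by nlinarith
    have h5 : (0 : ℝ) ≤ (2 * n) ^ n := by positivity
    have ha := abs_nonneg a
    calc |a| * |x| ^ n * Real.exp (-(1 / 2) * x ^ 2)
        = |a| * (|x| ^ n * Real.exp (-(1 / 2) * x ^ 2)) := by ring
      _ ≤ |a| * (1 + 2 ^ n * n !) := by gcongr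
      _ ≤ _ := by nlinarith [mul_nonneg ha h5]

theorem hermiteFun_eq_poly (n : ℕ) :
    ∃ q : Polynomial ℝ, hermiteFun n = fun x => q.eval x * Real.exp (-(1 / 2) * x ^ 2) := by
  obtain ⟨q, hq⟩ := iteratedDeriv_poly_gauss 1 n 1
  refine ⟨Polynomial.C ((-1) ^ n * hermiteConst n) * q, ?_⟩
  funext x
  have h : (fun y : ℝ => Real.exp (-y ^ 2)) =
      fun y => (1 : Polynomial ℝ).eval y * Real.exp (-1 * y ^ 2) := by
    funext y; simp
  have hE : Real.exp (x ^ 2 / 2) * Real.exp (-1 * x ^ 2) = Real.exp (-(1 / 2) * x ^ 2) := by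
    rw [← Real.exp_add]; ring_nf
  rw [hermiteFun, h, hq, ← hE]
  simp only [Polynomial.eval_mul, Polynomial.eval_C]
  ring

/-- The Hermite function as a real-valued Schwartz function. -/
def hermiteSchwartzReal (n : ℕ) : 𝓢(ℝ, ℝ) where
  toFun := hermiteFun n
  smooth' := by
    obtain ⟨q, hq⟩ := hermiteFun_eq_poly n
    rw [hq]
    have h1 : ContDiff ℝ ∞ (fun x : ℝ => q.eval x) := by
      simpa using q.contDiff_aeval (𝕜 := ℝ) ∞
    exact h1.mul (Real.contDiff_exp.comp (contDiff_const.mul (contDiff_id.pow 2)))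
  decay' := by
    intro k m
    obtain ⟨q, hq⟩ := hermiteFun_eq_poly n
    obtain ⟨r, hr⟩ := iteratedDeriv_poly_gauss (1 / 2) m q
    obtain ⟨C, hC⟩ := poly_gauss_bounded (Polynomial.X ^ k * r)
    refine ⟨C, fun x => ?_⟩
    rw [norm_iteratedFDeriv_eq_norm_iteratedDeriv, hq, hr]
    refine le_trans (le_of_eq ?_) (hC x)
    simp [abs_mul, mul_assoc]

/-- The Hermite function as a complex-valued Schwartz function. -/
def hermiteSchwartz (n : ℕ) : 𝓢(ℝ, ℂ) :=
  SchwartzMap.postcompCLM (𝕜 := ℝ) Complex.ofRealCLM (hermiteSchwartzReal n)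

theorem hermiteSchwartz_apply (n : ℕ) (x : ℝ) : hermiteSchwartz n x = (hermiteFun n x : ℂ) := rfl

/-! ## The spaces `ℋ^s(ℝ)` -/

/-- The coefficient `c_n` of `u = ∑ c_n h_n`: the tempered distribution `u` tested against the
(real-valued) function `h_n`. -/
def coeff (u : 𝓢'(ℝ, ℂ)) (n : ℕ) : ℂ := u (hermiteSchwartz n)

theorem coeff_add (u v : 𝓢'(ℝ, ℂ)) (n : ℕ) : coeff (u + v) n = coeff u n + coeff v n := rfl

theorem coeff_smul (a : ℂ) (u : 𝓢'(ℝ, ℂ)) (n : ℕ) : coeff (a • u) n = a * coeff u n := rfl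

/-- The weighted coefficient sequence `(λ_n^s c_n)`. -/
def weightedCoeff (s : ℝ) (u : 𝓢'(ℝ, ℂ)) : ℕ → ℂ := fun n => ((freq n ^ s : ℝ) : ℂ) * coeff u n

theorem norm_weightedCoeff_sq (s : ℝ) (u : 𝓢'(ℝ, ℂ)) (n : ℕ) :
    ‖weightedCoeff s u n‖ ^ 2 = freq n ^ (2 * s) * ‖coeff u n‖ ^ 2 := by
  have h := (freq_pos n).le
  rw [weightedCoeff, norm_mul, mul_pow, Complex.norm_real, Real.norm_eq_abs, sq_abs,
    mul_comm 2 s, Real.rpow_mul h, Real.rpow_two]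

theorem memlp_weightedCoeff_iff (s : ℝ) (u : 𝓢'(ℝ, ℂ)) :
    Memℓp (weightedCoeff s u) 2 ↔ Summable fun n => freq n ^ (2 * s) * ‖coeff u n‖ ^ 2 := by
  rw [memℓp_gen_iff (by norm_num)]
  simp only [ENNReal.toReal_ofNat, Real.rpow_two, norm_weightedCoeff_sq]

/-- The tempered distributions `u` with `∑ λ_n^{2s} |c_n|² < ∞`. -/
def sobolevSubmodule (s : ℝ) : Submodule ℂ 𝓢'(ℝ, ℂ) where
  carrier := {u | Summable fun n => freq n ^ (2 * s) * ‖coeff u n‖ ^ 2}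
  add_mem' := by
    intro u v hu hv
    rw [mem_ofPred_eq, ← memlp_weightedCoeff_iff] at *
    have h : weightedCoeff s (u + v) = weightedCoeff s u + weightedCoeff s v := by
      funext n; simp [weightedCoeff, coeff_add, mul_add]
    rw [h]
    exact hu.add hv
  zero_mem' := by
    have h : ∀ n, coeff (0 : 𝓢'(ℝ, ℂ)) n = 0 := fun n => rfl
    simp [h, summable_zero]
  smul_mem' := by
    intro a u hu
    rw [mem_ofPred_eq] at *
    have h : (fun n => freq n ^ (2 * s) * ‖coeff (a • u) n‖ ^ 2) =
        fun n => ‖a‖ ^ 2 * (freq n ^ (2 * s) * ‖coeff u n‖ ^ 2) := by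
      funext n; rw [coeff_smul, norm_mul]; ring
    rw [h]
    exact hu.mul_left _

/-- The space `ℋ^s(ℝ)` associated with the harmonic oscillator. It is a type of its own so that
it carries the topology of its norm and not that of `𝓢'`. -/
def HSpace (s : ℝ) : Type := sobolevSubmodule s

instance (s : ℝ) : AddCommGroup (HSpace s) := inferInstanceAs (AddCommGroup (sobolevSubmodule s))

instance (s : ℝ) : Module ℂ (HSpace s) := inferInstanceAs (Module ℂ (sobolevSubmodule s))

/-- The tempered distribution underlying an element of `ℋ^s`. -/
def HSpace.toDistr {s : ℝ} (u : HSpace s) : 𝓢'(ℝ, ℂ) := Subtype.val u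

/-- `u ↦ (λ_n^s c_n)`, a linear map from `ℋ^s` to `ℓ²`. -/
def HSpace.toLp (s : ℝ) : HSpace s →ₗ[ℂ] lp (fun _ : ℕ => ℂ) 2 where
  toFun u := ⟨weightedCoeff s u.toDistr, (memlp_weightedCoeff_iff s _).2 u.2⟩
  map_add' u v := by
    ext n
    exact mul_add _ _ _
  map_smul' a u := by
    ext n
    exact mul_left_comm _ _ _

/-- The norm of `ℋ^s`, `‖u‖² = ∑ λ_n^{2s} |c_n|²` (see `HSpace.norm_sq`). It is registered as a
seminorm only to avoid proving here that the `h_n` span a dense subspace of `𝓢`; the topology and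
the Borel sets are those of the norm. -/
instance (s : ℝ) : SeminormedAddCommGroup (HSpace s) :=
  SeminormedAddCommGroup.induced (HSpace s) (lp (fun _ : ℕ => ℂ) 2) (HSpace.toLp s)

theorem HSpace.norm_sq {s : ℝ} (u : HSpace s) :
    ‖u‖ ^ 2 = ∑' n, freq n ^ (2 * s) * ‖coeff u.toDistr n‖ ^ 2 := by
  have h := lp.norm_rpow_eq_tsum (p := 2) (by norm_num) (HSpace.toLp s u)
  simp only [ENNReal.toReal_ofNat, Real.rpow_two] at h
  refine h.trans (tsum_congr fun n => ?_)
  exact norm_weightedCoeff_sq s u.toDistr n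

instance (s : ℝ) : MeasurableSpace (HSpace s) := borel _

instance (s : ℝ) : BorelSpace (HSpace s) := ⟨rfl⟩

/-! ## The Gaussian measure `μ` -/

/-- The law of a standard complex Gaussian, `π⁻¹ e^{-|z|²} dL(z)`. -/
def stdComplexGaussian : Measure ℂ :=
  (volume : Measure ℂ).withDensity fun z => ENNReal.ofReal (1 / Real.pi * Real.exp (-‖z‖ ^ 2))

theorem integral_complexGaussian :
    ∫ z : ℂ, (1 / Real.pi * Real.exp (-‖z‖ ^ 2)) = 1 := by
  have h := Complex.integral_exp_neg_mul_rpow (p := 2) (b := 1) (by norm_num) one_pos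
  have h2 : Real.Gamma (2 / 2 + 1) = 1 := by norm_num [Real.Gamma_two]
  rw [h2] at h
  simp only [neg_mul, one_mul, Real.rpow_two, Real.one_rpow, mul_one] at h
  rw [integral_const_mul, h]
  field_simp

instance : IsProbabilityMeasure stdComplexGaussian := by
  constructor
  have hint : Integrable fun z : ℂ => 1 / Real.pi * Real.exp (-‖z‖ ^ 2) := by
    by_contra hc
    have := integral_undef hc
    rw [integral_complexGaussian] at this
    exact one_ne_zero this
  rw [stdComplexGaussian, withDensity_apply _ MeasurableSet.univ, Measure.restrict_univ,
    ← ofReal_integral_eq_lintegral_ofReal hint (ae_of_all _ fun z => by positivity),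
    integral_complexGaussian, ENNReal.ofReal_one]

/-- The law of a sequence `(g_n)` of independent standard complex Gaussians. -/
def gaussianSeq : Measure (ℕ → ℂ) := Measure.infinitePi fun _ : ℕ => stdComplexGaussian

/-- The random series `φ = ∑ (√2 / λ_n) g_n h_n` in the space of tempered distributions. -/
def randomSeries (g : ℕ → ℂ) : 𝓢'(ℝ, ℂ) :=
  ∑' n, (((Real.sqrt 2 / freq n : ℝ) : ℂ) * g n) •
    (SchwartzMap.toTemperedDistributionCLM ℝ ℂ volume (hermiteSchwartz n))

open Classical in
/-- `φ` as a random variable with values in `ℋ^s`; for `s < 0` the series lies in `ℋ^s` almost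
surely, and the value `0` is used on the exceptional null set. -/
def randomElement (s : ℝ) (g : ℕ → ℂ) : HSpace s :=
  if h : randomSeries g ∈ sobolevSubmodule s then (⟨randomSeries g, h⟩ : sobolevSubmodule s) else 0

/-- The Gaussian measure `μ` on `ℋ^{-σ}`: the distribution of `φ`. -/
def freeMeasure (σ : ℝ) : Measure (HSpace (-σ)) := gaussianSeq.map (randomElement (-σ))

/-! ## The focusing Gibbs measures (cubic nonlinearity) -/

/-- The sharp spectral projection `Π_N u = ∑_{n ≤ N} c_n h_n`. -/
def sharpProj {s : ℝ} (N : ℕ) (u : HSpace s) (x : ℝ) : ℂ :=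
  ∑ n ∈ Finset.range (N + 1), coeff u.toDistr n * (hermiteFun n x : ℂ)

/-- The smooth cut-off `S_N u = ∑ χ((2n+1)/(2N+1)) c_n h_n`. -/
def smoothProj (χ : ℝ → ℝ) {s : ℝ} (N : ℕ) (u : HSpace s) (x : ℝ) : ℂ :=
  ∑' n : ℕ, (χ ((2 * n + 1) / (2 * N + 1)) : ℂ) * coeff u.toDistr n * (hermiteFun n x : ℂ)

/-- `α_N = ∑_{n ≤ N} 2 / λ_n²`, the mean of `‖Π_N u‖²_{L²}` under `μ`. -/
def renormConst (N : ℕ) : ℝ := ∑ n ∈ Finset.range (N + 1), 2 / freq n ^ 2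

/-- `G_N(u) = ζ(‖Π_N u‖²_{L²} - α_N) exp(¼ ∫ |S_N u|⁴)`. -/
def approxDensity (χ ζ : ℝ → ℝ) {s : ℝ} (N : ℕ) (u : HSpace s) : ℝ :=
  ζ ((∫ x : ℝ, ‖sharpProj N u x‖ ^ 2) - renormConst N) *
    Real.exp (1 / 4 * ∫ x : ℝ, ‖smoothProj χ N u x‖ ^ 4)

open Classical in
/-- `G`: the limit in `μ`-measure of `G_N` (determined up to a `μ`-null set). -/
def gibbsDensity (σ : ℝ) (χ ζ : ℝ → ℝ) : HSpace (-σ) → ℝ :=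
  if h : ∃ G : HSpace (-σ) → ℝ, Measurable G ∧
      TendstoInMeasure (freeMeasure σ) (fun N => approxDensity χ ζ N) atTop G
  then h.choose else 0

/-- The Gibbs measure `dρ_ζ = G dμ`. -/
def gibbsMeasure (σ : ℝ) (χ ζ : ℝ → ℝ) : Measure (HSpace (-σ)) :=
  (freeMeasure σ).withDensity fun u => ENNReal.ofReal (gibbsDensity σ χ ζ u)

/-- The cut-offs: nonnegative functions `ζ ∈ C_0^∞(ℝ)`. -/
def cutoffs : Set (ℝ → ℝ) := {ζ | ContDiff ℝ ∞ ζ ∧ HasCompactSupport ζ ∧ ∀ x, 0 ≤ ζ x}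

end HarmonicNLS

end

/-!
The argument has an analytic half, the existence of the limit density, and a probabilistic half, the
fact that the renormalised mass takes every value near every distribution.

*Green function.* The ladder relations give the orthonormality of the `h_n` and the eigenvalue
equation `-h_n'' + x² h_n = λ_n² h_n`. For fixed `x` and a finite set of modes, let `f` be the
function `∑ λ_n⁻² h_n(x) h_n`. Its value at `x` is the truncated diagonal Green function
`∑ h_n(x)² / λ_n²`, and so is its energy `∫ f'² + y² f²`. A weighted Agmon inequality bounds
`(1 + |x|) f(x)²` by the energy, so the kernel is at most `4 / (1 + |x|)`
(`sum_hermiteFun_sq_div_le`). Hence the Green function on the diagonal is in `L²(dx)`, with tails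
tending to zero there, and no pointwise asymptotics of Hermite functions are needed.

*Limits.* The random series converges almost surely in `𝓢'`, because the transpose of the harmonic
oscillator carries `L²` convergence of the series divided by `λ_n²` to it; so under `μ` the
coefficients are `√2 λ_n⁻¹ g_n` (`ae_coeff_randomElement`). The renormalised mass is a sum of
independent centred variables with variances `4 / λ_n⁴`, hence Cauchy in `L²(μ)`
(`exists_limit_renormMass`). The fourth moment of a Gaussian sum is at most three times the square
of its variance, and the variance of `S_n u(x) - S_m u(x)` is bounded by a tail of the Green
function; with the reverse triangle inequality, `‖S_N u‖_{L⁴}` is Cauchy in `L⁴(μ)`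
(`exists_limit_smoothNorm`). If `X` and `Z` are the two limits, then `G_ζ = ζ(X) exp(Z⁴ / 4)`.

*Supports.* In every ball of `ℋ^{-σ}` the variable `X` charges every interval
(`freeMeasure_pos_near`). Setting high modes to zero lowers the mass as far as desired, since
`∑ 2 / λ_n²` diverges, and one mode of very high frequency raises it again; both cost little in
`ℋ^{-σ}` (`exists_profile`). Finitely many coordinates come close to this profile with positive
probability, and the remaining ones are independent of them and contribute little with probability
at least one half. Taking an interval on which `ζ > 0`, every `ρ_ζ` with `ζ ≠ 0` has full support, and
so has `μ`.
-/

namespace HarmonicNLS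

/-! ### Ladder relations and orthonormality of the Hermite functions -/

theorem hermiteConst_eq_sqrt_mul_succ (n : ℕ) :
    hermiteConst n = √(2 * n + 2) * hermiteConst (n + 1) := by
  have h1 : ((2 : ℝ) ^ (((n + 1 : ℕ) : ℝ) / 2)) = 2 ^ ((n : ℝ) / 2) * √2 := by
    rw [Real.sqrt_eq_rpow, ← Real.rpow_add two_pos]; push_cast; ring_nf
  have h2 : (((n + 1)! : ℕ) : ℝ) ^ (1 / 2 : ℝ) = √(n + 1) * ((n ! : ℕ) : ℝ) ^ (1 / 2 : ℝ) := by
    rw [← Real.sqrt_eq_rpow, ← Real.sqrt_eq_rpow, ← Real.sqrt_mul (by positivity),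
      Nat.factorial_succ]
    push_cast; rfl
  have h3 : √(2 * (n : ℝ) + 2) = √2 * √(n + 1) := by
    rw [← Real.sqrt_mul (by positivity)]; ring_nf
  have : 0 < √((n : ℝ) + 1) := Real.sqrt_pos.2 (by positivity)
  rw [hermiteConst, hermiteConst, h1, h2, h3]
  field_simp

/-- The raising relation `h_n' = x h_n - √(2n+2) h_{n+1}`. -/
theorem hasDerivAt_hermiteFun (n : ℕ) (x : ℝ) :
    HasDerivAt (hermiteFun n) (x * hermiteFun n x - √(2 * n + 2) * hermiteFun (n + 1) x) x := by
  have hg : ContDiff ℝ ∞ (fun y : ℝ => Real.exp (-y ^ 2)) := by fun_prop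
  have h1 : HasDerivAt (iteratedDeriv n fun y : ℝ => Real.exp (-y ^ 2))
      (iteratedDeriv (n + 1) (fun y : ℝ => Real.exp (-y ^ 2)) x) x := by
    rw [iteratedDeriv_succ]
    exact (hg.differentiable_iteratedDeriv n (by exact_mod_cast ENat.natCast_lt_top n) x).hasDerivAt
  have h2 : HasDerivAt (fun y : ℝ => Real.exp (y ^ 2 / 2)) (Real.exp (x ^ 2 / 2) * x) x := by
    have : HasDerivAt (fun y : ℝ => y ^ 2 / 2) x x := by
      simpa using (hasDerivAt_pow 2 x).div_const 2
    exact this.exp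
  have h3 := (h2.const_mul ((-1) ^ n * hermiteConst n)).mul h1
  refine h3.congr_deriv ?_
  rw [hermiteFun, hermiteFun, hermiteConst_eq_sqrt_mul_succ n]
  ring

theorem deriv_hermiteFun (n : ℕ) (x : ℝ) :
    deriv (hermiteFun n) x = x * hermiteFun n x - √(2 * n + 2) * hermiteFun (n + 1) x :=
  (hasDerivAt_hermiteFun n x).deriv

/-- The three-term recurrence; it follows by induction on differentiating and using the raising
relation. For `n = 0` the truncated index `n - 1` is harmless, its coefficient being zero. -/
theorem hermiteFun_recurrence (n : ℕ) (x : ℝ) :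
    2 * x * hermiteFun n x =
      √(2 * n) * hermiteFun (n - 1) x + √(2 * n + 2) * hermiteFun (n + 1) x := by
  induction n generalizing x with
  | zero =>
    have h0 : hermiteFun 0 = fun x => hermiteConst 0 * Real.exp (-(1 / 2) * x ^ 2) := by
      funext x
      simp only [hermiteFun, pow_zero, one_mul, iteratedDeriv_zero]
      rw [mul_assoc, ← Real.exp_add]; ring_nf
    have h1 : HasDerivAt (hermiteFun 0) (-x * hermiteFun 0 x) x := by
      have h2 : HasDerivAt (fun y : ℝ => -(1 / 2) * y ^ 2) (-x) x := by
        convert! (hasDerivAt_pow 2 x).const_mul (-(1 / 2) : ℝ) using 1; simp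
      rw [h0]
      refine (h2.exp.const_mul (hermiteConst 0)).congr_deriv ?_
      ring
    have h3 := h1.unique (hasDerivAt_hermiteFun 0 x)
    simp only [CharP.cast_eq_zero, mul_zero, zero_add, Real.sqrt_zero, zero_mul] at h3 ⊢
    linarith
  | succ n ih =>
    have hL : HasDerivAt (fun y => 2 * y * hermiteFun n y)
        (2 * hermiteFun n x +
          2 * x * (x * hermiteFun n x - √(2 * n + 2) * hermiteFun (n + 1) x)) x := by
      refine (((hasDerivAt_id x).const_mul 2).mul (hasDerivAt_hermiteFun n x)).congr_deriv ?_
      simp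
    have hR := ((hasDerivAt_hermiteFun (n - 1) x).const_mul √(2 * (n : ℝ))).add
      ((hasDerivAt_hermiteFun (n + 1) x).const_mul √(2 * (n : ℝ) + 2))
    have hfun : (fun y => 2 * y * hermiteFun n y) =
        (fun y => √(2 * (n : ℝ)) * hermiteFun (n - 1) y) +
          fun y => √(2 * (n : ℝ) + 2) * hermiteFun (n + 1) y := funext fun y => ih y
    rw [← hfun] at hR
    have h := hL.unique hR
    have hs : √(2 * (n : ℝ)) * √(2 * ((n - 1 : ℕ) : ℝ) + 2) * hermiteFun (n - 1 + 1) x =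
        2 * n * hermiteFun n x := by
      rcases n with _ | m
      · simp
      · have h4 : (2 : ℝ) * ((m + 1 - 1 : ℕ) : ℝ) + 2 = 2 * ((m + 1 : ℕ) : ℝ) := by
          push_cast [Nat.add_sub_cancel]; ring
        rw [h4, Real.mul_self_sqrt (by positivity), Nat.add_sub_cancel]
    have hpos : 0 < √(2 * (n : ℝ) + 2) := Real.sqrt_pos.2 (by positivity)
    have hsq : √(2 * (n : ℝ) + 2) * √(2 * (n : ℝ) + 2) = 2 * n + 2 :=
      Real.mul_self_sqrt (by positivity)
    have hc : (2 * ((n + 1 : ℕ) : ℝ)) = 2 * n + 2 := by push_cast; ring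
    rw [Nat.add_sub_cancel, hc]
    apply mul_left_cancel₀ hpos.ne'
    have ihx := ih x
    rw [hc] at h
    linear_combination -h + x * ihx + hs - hermiteFun n x * hsq

theorem mul_hermiteFun (n : ℕ) (x : ℝ) :
    x * hermiteFun n x =
      √(2 * n) / 2 * hermiteFun (n - 1) x + √(2 * n + 2) / 2 * hermiteFun (n + 1) x := by
  linarith [hermiteFun_recurrence n x]

theorem deriv_hermiteFun_eq_ladder (n : ℕ) (x : ℝ) :
    deriv (hermiteFun n) x =
      √(2 * n) / 2 * hermiteFun (n - 1) x - √(2 * n + 2) / 2 * hermiteFun (n + 1) x := by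
  rw [deriv_hermiteFun, mul_hermiteFun]; ring

/-- The Hermite functions are eigenfunctions of the harmonic oscillator. -/
theorem deriv_deriv_hermiteFun (n : ℕ) (x : ℝ) :
    deriv (deriv (hermiteFun n)) x = (x ^ 2 - freq n ^ 2) * hermiteFun n x := by
  have hf : freq n ^ 2 = 2 * n + 1 := Real.sq_sqrt (by positivity)
  have hd : deriv (hermiteFun n) =
      fun x => x * hermiteFun n x - √(2 * n + 2) * hermiteFun (n + 1) x :=
    funext (deriv_hermiteFun n)
  have h1 : HasDerivAt (fun x => x * hermiteFun n x - √(2 * n + 2) * hermiteFun (n + 1) x)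
      (1 * hermiteFun n x + x * (x * hermiteFun n x - √(2 * n + 2) * hermiteFun (n + 1) x) -
        √(2 * n + 2) * (x * hermiteFun (n + 1) x -
          √(2 * ((n + 1 : ℕ) : ℝ) + 2) * hermiteFun (n + 1 + 1) x)) x :=
    ((hasDerivAt_id x).mul (hasDerivAt_hermiteFun n x)).sub
      ((hasDerivAt_hermiteFun (n + 1) x).const_mul _)
  have hsq : √(2 * (n : ℝ) + 2) * √(2 * (n : ℝ) + 2) = 2 * n + 2 :=
    Real.mul_self_sqrt (by positivity)
  have hr := hermiteFun_recurrence (n + 1) x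
  have hc : (2 * ((n + 1 : ℕ) : ℝ)) = 2 * n + 2 := by push_cast; ring
  rw [Nat.add_sub_cancel, hc] at hr
  rw [hd, h1.deriv, hf, hc]
  linear_combination (-√(2 * (n : ℝ) + 2)) * hr + (- hermiteFun n x) * hsq

theorem integrable_hermiteFun_mul (n m : ℕ) :
    Integrable fun x => hermiteFun n x * hermiteFun m x :=
  (SchwartzMap.pairing (ContinuousLinearMap.mul ℝ ℝ) (hermiteSchwartzReal n)
    (hermiteSchwartzReal m)).integrable

/-- Integration by parts turns the raising operator into the lowering operator. -/
theorem sqrt_mul_integral_hermiteFun_succ (n m : ℕ) :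
    √(2 * n + 2) * ∫ x, hermiteFun (n + 1) x * hermiteFun m x =
      √(2 * m) * ∫ x, hermiteFun n x * hermiteFun (m - 1) x := by
  have hp := SchwartzMap.integral_mul_deriv_eq_neg_deriv_mul (hermiteSchwartzReal n)
    (hermiteSchwartzReal m)
  have hp' : ∫ x, hermiteFun n x * deriv (hermiteFun m) x =
    -∫ x, deriv (hermiteFun n) x * hermiteFun m x := hp
  have e1 : ∫ x, hermiteFun n x * deriv (hermiteFun m) x =
      √(2 * m) / 2 * (∫ x, hermiteFun n x * hermiteFun (m - 1) x) -
        √(2 * m + 2) / 2 * ∫ x, hermiteFun n x * hermiteFun (m + 1) x := by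
    rw [← integral_const_mul, ← integral_const_mul, ← integral_sub
      ((integrable_hermiteFun_mul _ _).const_mul _) ((integrable_hermiteFun_mul _ _).const_mul _)]
    congr 1; funext x; rw [deriv_hermiteFun_eq_ladder]; ring
  have e2 : ∫ x, deriv (hermiteFun n) x * hermiteFun m x =
      √(2 * n) / 2 * (∫ x, hermiteFun (n - 1) x * hermiteFun m x) -
        √(2 * n + 2) / 2 * ∫ x, hermiteFun (n + 1) x * hermiteFun m x := by
    rw [← integral_const_mul, ← integral_const_mul, ← integral_sub
      ((integrable_hermiteFun_mul _ _).const_mul _) ((integrable_hermiteFun_mul _ _).const_mul _)]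
    congr 1; funext x; rw [deriv_hermiteFun_eq_ladder]; ring
  have e3 : ∫ x, x * hermiteFun n x * hermiteFun m x =
      √(2 * m) / 2 * (∫ x, hermiteFun n x * hermiteFun (m - 1) x) +
        √(2 * m + 2) / 2 * ∫ x, hermiteFun n x * hermiteFun (m + 1) x := by
    rw [← integral_const_mul, ← integral_const_mul, ← integral_add
      ((integrable_hermiteFun_mul _ _).const_mul _) ((integrable_hermiteFun_mul _ _).const_mul _)]
    congr 1; funext x
    linear_combination hermiteFun n x * mul_hermiteFun m x
  have e4 : ∫ x, x * hermiteFun n x * hermiteFun m x =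
      √(2 * n) / 2 * (∫ x, hermiteFun (n - 1) x * hermiteFun m x) +
        √(2 * n + 2) / 2 * ∫ x, hermiteFun (n + 1) x * hermiteFun m x := by
    rw [← integral_const_mul, ← integral_const_mul, ← integral_add
      ((integrable_hermiteFun_mul _ _).const_mul _) ((integrable_hermiteFun_mul _ _).const_mul _)]
    congr 1; funext x
    linear_combination hermiteFun m x * mul_hermiteFun n x
  linarith

theorem integral_hermiteFun_zero_sq : ∫ x, hermiteFun 0 x * hermiteFun 0 x = 1 := by
  have h0 : ∀ x, hermiteFun 0 x * hermiteFun 0 x = hermiteConst 0 ^ 2 * Real.exp (-1 * x ^ 2) := by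
    intro x
    simp only [hermiteFun, pow_zero, one_mul, iteratedDeriv_zero]
    have : Real.exp (-1 * x ^ 2) =
        (Real.exp (x ^ 2 / 2) * Real.exp (-x ^ 2)) *
          (Real.exp (x ^ 2 / 2) * Real.exp (-x ^ 2)) := by
      rw [← Real.exp_add, ← Real.exp_add]; ring_nf
    rw [this]; ring
  have hpi : (Real.pi ^ (1 / 4 : ℝ)) ^ 2 = √Real.pi := by
    rw [Real.sqrt_eq_rpow, ← Real.rpow_natCast, ← Real.rpow_mul Real.pi_pos.le]; norm_num
  have : 0 < √Real.pi := Real.sqrt_pos.2 Real.pi_pos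
  simp_rw [h0]
  rw [integral_const_mul, integral_gaussian]
  simp only [hermiteConst, Nat.factorial_zero, Nat.cast_one, Real.one_rpow, CharP.cast_eq_zero,
    zero_div, Real.rpow_zero, one_mul, div_one, div_pow, one_pow, hpi]
  field_simp

theorem integral_hermiteFun_mul (n m : ℕ) :
    ∫ x, hermiteFun n x * hermiteFun m x = if n = m then 1 else 0 := by
  induction n generalizing m with
  | zero =>
    rcases m with _ | m
    · simpa using integral_hermiteFun_zero_sq
    · have h := sqrt_mul_integral_hermiteFun_succ m 0
      have hpos : √(2 * (m : ℝ) + 2) ≠ 0 := (Real.sqrt_pos.2 (by positivity)).ne'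
      simp only [CharP.cast_eq_zero, mul_zero, Real.sqrt_zero, zero_mul, mul_eq_zero, hpos,
        false_or] at h
      simp_rw [mul_comm (hermiteFun 0 _)]
      simpa using h
  | succ n ih =>
    have hpos : √(2 * (n : ℝ) + 2) ≠ 0 := (Real.sqrt_pos.2 (by positivity)).ne'
    have h := sqrt_mul_integral_hermiteFun_succ n m
    rw [ih] at h
    rcases m with _ | m
    · simpa [hpos] using h
    · have hc : (2 * ((m + 1 : ℕ) : ℝ)) = 2 * m + 2 := by push_cast; ring
      rw [Nat.add_sub_cancel, hc] at h
      by_cases hnm : n = m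
      · subst hnm
        simpa [hpos] using h
      · simpa [hnm, hpos] using h

/-! ### The diagonal of the Green function of the harmonic oscillator -/

theorem integral_sum_hermiteFun_mul_sum (s : Finset ℕ) (b c : ℕ → ℝ) :
    ∫ x, (∑ n ∈ s, b n * hermiteFun n x) * (∑ n ∈ s, c n * hermiteFun n x) =
      ∑ n ∈ s, b n * c n := by
  have h : ∀ x, (∑ n ∈ s, b n * hermiteFun n x) * (∑ n ∈ s, c n * hermiteFun n x) =
      ∑ n ∈ s, ∑ m ∈ s, b n * c m * (hermiteFun n x * hermiteFun m x) := by
    intro x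
    rw [Finset.sum_mul_sum]
    exact Finset.sum_congr rfl fun n _ => Finset.sum_congr rfl fun m _ => by ring
  simp_rw [h]
  rw [integral_finsetSum _ fun n _ => integrable_finsetSum _ fun m _ =>
    (integrable_hermiteFun_mul n m).const_mul _]
  refine Finset.sum_congr rfl fun n hn => ?_
  rw [integral_finsetSum _ fun m _ => (integrable_hermiteFun_mul n m).const_mul _]
  simp_rw [integral_const_mul, integral_hermiteFun_mul]
  simp [hn]

theorem schwartzMap_abs_le_integral_deriv (F : 𝓢(ℝ, ℝ)) (x : ℝ) : |F x| ≤ ∫ y, |deriv F y| := by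
  have hint : Integrable (deriv F) := (SchwartzMap.derivCLM ℝ ℝ F).integrable
  have hbot : Tendsto F atBot (𝓝 0) :=
    (SchwartzMap.tendsto_cocompact F).mono_left atBot_le_cocompact
  have h := integral_Iic_of_hasDerivAt_of_tendsto' (a := x) (fun y _ => F.hasDerivAt y)
    hint.integrableOn hbot
  rw [sub_zero] at h
  rw [← h]
  exact (abs_integral_le_integral_abs).trans
    (setIntegral_le_integral hint.abs (Eventually.of_forall fun y => abs_nonneg _))

/-- Multiplication of a Schwartz function by the variable. -/
noncomputable def mulVar (f : 𝓢(ℝ, ℝ)) : 𝓢(ℝ, ℝ) := SchwartzMap.smulLeftCLM ℝ (fun x : ℝ => x) f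

theorem mulVar_apply (f : 𝓢(ℝ, ℝ)) (x : ℝ) : mulVar f x = x * f x :=
  SchwartzMap.smulLeftCLM_apply_apply (by fun_prop) f x

theorem schwartzMap_integrable_mul (f g : 𝓢(ℝ, ℝ)) : Integrable fun x => f x * g x :=
  (SchwartzMap.pairing (ContinuousLinearMap.mul ℝ ℝ) f g).integrable

theorem schwartzMap_integrable_sq (f : 𝓢(ℝ, ℝ)) : Integrable fun x => f x ^ 2 := by
  simpa only [sq] using schwartzMap_integrable_mul f f

theorem schwartzMap_integrable_deriv_sq (f : 𝓢(ℝ, ℝ)) : Integrable fun x => deriv f x ^ 2 :=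
  schwartzMap_integrable_sq (SchwartzMap.derivCLM ℝ ℝ f)

theorem schwartzMap_integrable_mulVar_sq (f : 𝓢(ℝ, ℝ)) : Integrable fun x => (x * f x) ^ 2 := by
  simpa only [mulVar_apply] using schwartzMap_integrable_sq (mulVar f)

/-- A weighted Agmon inequality, obtained by integrating the derivatives of `f²` and `x f²`. -/
theorem one_add_abs_mul_sq_le (f : 𝓢(ℝ, ℝ)) (x : ℝ) :
    (1 + |x|) * f x ^ 2 ≤
      2 * (∫ y, f y ^ 2) + 2 * ((∫ y, deriv f y ^ 2) + ∫ y, (y * f y) ^ 2) := by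
  have hf := schwartzMap_integrable_sq f
  have hd := schwartzMap_integrable_deriv_sq f
  have hx := schwartzMap_integrable_mulVar_sq f
  have h1 := schwartzMap_abs_le_integral_deriv
    (SchwartzMap.pairing (ContinuousLinearMap.mul ℝ ℝ) f f) x
  have h2 := schwartzMap_abs_le_integral_deriv
    (SchwartzMap.pairing (ContinuousLinearMap.mul ℝ ℝ) (mulVar f) f) x
  have e1 : ⇑(SchwartzMap.pairing (ContinuousLinearMap.mul ℝ ℝ) f f) = fun y => f y * f y := rfl
  have e2 : ⇑(SchwartzMap.pairing (ContinuousLinearMap.mul ℝ ℝ) (mulVar f) f) =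
      fun y => y * f y * f y := by
    funext y; rw [SchwartzMap.pairing_apply_apply, mulVar_apply]; rfl
  have d1 : ∀ y, deriv (fun y => f y * f y) y = 2 * f y * deriv f y := fun y => by
    rw [((f.hasDerivAt y).fun_mul (f.hasDerivAt y)).deriv]; ring
  have d2 : ∀ y, deriv (fun y => y * f y * f y) y = f y ^ 2 + 2 * (y * f y) * deriv f y :=
    fun y => by
    rw [(((hasDerivAt_id' y).fun_mul (f.hasDerivAt y)).fun_mul (f.hasDerivAt y)).deriv]; ring
  rw [e1] at h1
  rw [e2] at h2
  have b1 : ∫ y, |deriv (fun y => f y * f y) y| ≤ ∫ y, (f y ^ 2 + deriv f y ^ 2) := by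
    refine integral_mono_of_nonneg (Eventually.of_forall fun y => abs_nonneg _) (hf.add hd)
      (Eventually.of_forall fun y => ?_)
    simp only [d1]
    rw [abs_le]
    constructor <;> nlinarith [sq_nonneg (f y - deriv f y), sq_nonneg (f y + deriv f y)]
  have b2 : ∫ y, |deriv (fun y => y * f y * f y) y| ≤
      ∫ y, (f y ^ 2 + (deriv f y ^ 2 + (y * f y) ^ 2)) := by
    refine integral_mono_of_nonneg (Eventually.of_forall fun y => abs_nonneg _)
      (hf.add (hd.add hx)) (Eventually.of_forall fun y => ?_)
    simp only [d2]
    rw [abs_le]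
    constructor <;> nlinarith [sq_nonneg (y * f y - deriv f y), sq_nonneg (y * f y + deriv f y),
      sq_nonneg (f y)]
  rw [integral_add hf hd] at b1
  have hdx : Integrable fun y => deriv f y ^ 2 + (y * f y) ^ 2 := hd.add hx
  rw [integral_add hf hdx, integral_add hd hx] at b2
  have a1 : |f x * f x| = f x ^ 2 := by rw [← sq, abs_of_nonneg (sq_nonneg _)]
  have a2 : |x * f x * f x| = |x| * f x ^ 2 := by
    rw [mul_assoc, abs_mul, a1]
  rw [a1] at h1
  rw [a2] at h2
  have h3 : 0 ≤ ∫ y, (y * f y) ^ 2 := integral_nonneg fun y => sq_nonneg _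
  linarith

theorem freq_sq (n : ℕ) : freq n ^ 2 = 2 * n + 1 := Real.sq_sqrt (by positivity)

theorem one_le_freq_sq (n : ℕ) : 1 ≤ freq n ^ 2 := by
  rw [freq_sq]; linarith [(Nat.cast_nonneg n : (0 : ℝ) ≤ n)]

/-- The quadratic form of the harmonic oscillator on a finite Hermite expansion. -/
theorem energy_sum_hermite (s : Finset ℕ) (b : ℕ → ℝ) :
    (∫ y, deriv (⇑(∑ n ∈ s, b n • hermiteSchwartzReal n)) y ^ 2) +
      ∫ y, (y * (∑ n ∈ s, b n • hermiteSchwartzReal n) y) ^ 2 =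
      ∑ n ∈ s, freq n ^ 2 * b n ^ 2 := by
  set f : 𝓢(ℝ, ℝ) := ∑ n ∈ s, b n • hermiteSchwartzReal n with hf
  have hfx : ∀ x, f x = ∑ n ∈ s, b n * hermiteFun n x := fun x => by
    rw [hf, _root_.sum_apply]; rfl
  have hdd : ∀ x, SchwartzMap.derivCLM ℝ ℝ (SchwartzMap.derivCLM ℝ ℝ f) x =
      ∑ n ∈ s, b n * ((x ^ 2 - freq n ^ 2) * hermiteFun n x) := fun x => by
    rw [hf, map_sum, map_sum, _root_.sum_apply]
    refine Finset.sum_congr rfl fun n _ => ?_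
    rw [map_smul, map_smul]
    change b n * deriv (deriv (hermiteFun n)) x = _
    rw [deriv_deriv_hermiteFun]
  have hibp : ∫ y, deriv f y ^ 2 =
      -∫ y, f y * SchwartzMap.derivCLM ℝ ℝ (SchwartzMap.derivCLM ℝ ℝ f) y := by
    have := SchwartzMap.integral_mul_deriv_eq_neg_deriv_mul f (SchwartzMap.derivCLM ℝ ℝ f)
    have h2 : ∫ y, deriv f y ^ 2 = ∫ y, deriv f y * (SchwartzMap.derivCLM ℝ ℝ f) y := by
      simp only [SchwartzMap.derivCLM_apply, sq]
    rw [h2, ← neg_eq_iff_eq_neg.2 this]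
    rfl
  have hneg : Integrable fun y =>
      -(f y * SchwartzMap.derivCLM ℝ ℝ (SchwartzMap.derivCLM ℝ ℝ f) y) :=
    (schwartzMap_integrable_mul _ _).neg
  rw [hibp, ← integral_neg, ← integral_add hneg (schwartzMap_integrable_mulVar_sq f)]
  have : ∀ y, -(f y * SchwartzMap.derivCLM ℝ ℝ (SchwartzMap.derivCLM ℝ ℝ f) y) + (y * f y) ^ 2 =
      (∑ n ∈ s, b n * hermiteFun n y) * ∑ n ∈ s, (freq n ^ 2 * b n) * hermiteFun n y := by
    intro y
    have e : SchwartzMap.derivCLM ℝ ℝ (SchwartzMap.derivCLM ℝ ℝ f) y =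
        y ^ 2 * f y - ∑ n ∈ s, (freq n ^ 2 * b n) * hermiteFun n y := by
      rw [hdd, hfx, Finset.mul_sum, ← Finset.sum_sub_distrib]
      exact Finset.sum_congr rfl fun n _ => by ring
    rw [e, ← hfx]; ring
  simp_rw [this, integral_sum_hermiteFun_mul_sum]
  exact Finset.sum_congr rfl fun n _ => by ring

/-- The kernel `∑_{n ∈ s} h_n(x)² / λ_n²` is at most `4 / (1 + |x|)`, uniformly in `s`: it is the
value at `x` of the function `f = ∑_{n ∈ s} λ_n⁻² h_n(x) h_n`, whose energy is that same value, so
that the Agmon inequality for `f` closes on itself. -/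
theorem sum_hermiteFun_sq_div_le (s : Finset ℕ) (x : ℝ) :
    ∑ n ∈ s, hermiteFun n x ^ 2 / freq n ^ 2 ≤ 4 / (1 + |x|) := by
  set K := ∑ n ∈ s, hermiteFun n x ^ 2 / freq n ^ 2 with hK
  let b : ℕ → ℝ := fun n => hermiteFun n x / freq n ^ 2
  have hpos : ∀ n, 0 < freq n ^ 2 := fun n => pow_pos (freq_pos n) 2
  have hfx : ∀ y, (∑ n ∈ s, b n • hermiteSchwartzReal n) y = ∑ n ∈ s, b n * hermiteFun n y :=
    fun y => by rw [_root_.sum_apply]; rfl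
  have h := one_add_abs_mul_sq_le (∑ n ∈ s, b n • hermiteSchwartzReal n) x
  rw [energy_sum_hermite] at h
  have h1 : (∑ n ∈ s, b n • hermiteSchwartzReal n) x = K := by
    rw [hfx, hK]
    exact Finset.sum_congr rfl fun n _ => by simp only [b]; ring
  have h2 : ∫ y, (∑ n ∈ s, b n • hermiteSchwartzReal n) y ^ 2 ≤ K := by
    simp_rw [hfx, sq, integral_sum_hermiteFun_mul_sum]
    refine Finset.sum_le_sum fun n _ => ?_
    have h3 : b n * b n = hermiteFun n x ^ 2 / freq n ^ 2 / freq n ^ 2 := by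
      simp only [b]; field_simp
    rw [h3]
    exact div_le_self (by positivity) (one_le_freq_sq n)
  have h4 : ∑ n ∈ s, freq n ^ 2 * b n ^ 2 = K := by
    refine Finset.sum_congr rfl fun n _ => ?_
    have := (hpos n).ne'
    simp only [b]; field_simp
  rw [h1, h4] at h
  have hK0 : 0 ≤ K := Finset.sum_nonneg fun n _ => by positivity
  have hx : 0 < 1 + |x| := by positivity
  rw [le_div_iff₀ hx]
  rcases hK0.eq_or_lt with h0 | h0
  · rw [← h0]; norm_num
  · refine le_of_mul_le_mul_right ?_ h0
    nlinarith

theorem summable_hermiteFun_sq_div (x : ℝ) :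
    Summable fun n => hermiteFun n x ^ 2 / freq n ^ 2 :=
  summable_of_sum_le (fun n => by positivity) fun s => sum_hermiteFun_sq_div_le s x

theorem continuous_hermiteFun (n : ℕ) : Continuous (hermiteFun n) :=
  (hermiteSchwartzReal n).continuous

/-- Tails of the Green function on the diagonal tend to zero in `L²`. -/
theorem tendsto_integral_tail_sq :
    Tendsto (fun k : ℕ => ∫⁻ x : ℝ, ENNReal.ofReal
      ((∑' n, hermiteFun (n + k) x ^ 2 / freq (n + k) ^ 2) ^ 2)) atTop (𝓝 0) := by
  have hnn : ∀ k x, 0 ≤ ∑' n, hermiteFun (n + k) x ^ 2 / freq (n + k) ^ 2 :=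
    fun k x => tsum_nonneg fun n => by positivity
  have hb : ∀ k x, ∑' n, hermiteFun (n + k) x ^ 2 / freq (n + k) ^ 2 ≤ 4 / (1 + |x|) := by
    intro k x
    refine Real.tsum_le_of_sum_le (fun n => by positivity) fun s => ?_
    have := sum_hermiteFun_sq_div_le (s.map (addRightEmbedding k)) x
    simpa using this
  have h0 : (0 : ℝ≥0∞) = ∫⁻ x : ℝ, 0 := by simp
  rw [h0]
  refine tendsto_lintegral_of_dominated_convergence
    (fun x : ℝ => ENNReal.ofReal (16 * (1 + x ^ 2)⁻¹)) ?_ ?_ ?_ ?_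
  · intro k
    refine (Measurable.pow_const ?_ 2).ennreal_ofReal
    exact Measurable.tsum fun n => (((continuous_hermiteFun _).measurable.pow_const 2).div_const _)
  · refine fun k => Eventually.of_forall fun x => ENNReal.ofReal_le_ofReal ?_
    calc _ ≤ (4 / (1 + |x|)) ^ 2 := pow_le_pow_left₀ (hnn k x) (hb k x) 2
      _ ≤ 16 * (1 + x ^ 2)⁻¹ := by
        rw [div_pow, ← div_eq_mul_inv]
        have : 1 + x ^ 2 ≤ (1 + |x|) ^ 2 := by
          nlinarith [sq_abs x, abs_nonneg x]
        norm_num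
        gcongr
  · exact ((integrable_inv_one_add_sq.const_mul 16).lintegral_lt_top).ne
  · refine Eventually.of_forall fun x => ?_
    have := (tendsto_sum_nat_add fun n => hermiteFun n x ^ 2 / freq n ^ 2)
    have h2 := ENNReal.tendsto_ofReal (this.pow 2)
    simpa using h2

/-! ### Moments of the standard complex Gaussian -/

theorem lintegral_norm_pow_stdComplexGaussian (k : ℕ) :
    ∫⁻ z, ENNReal.ofReal (‖z‖ ^ (2 * k)) ∂stdComplexGaussian = ENNReal.ofReal (k ! : ℕ) := by
  have h := Complex.integral_rpow_mul_exp_neg_rpow (p := 2) (q := 2 * k) (by norm_num)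
    (by linarith [(Nat.cast_nonneg k : (0 : ℝ) ≤ k)])
  have hG : Real.Gamma ((2 * (k : ℝ) + 2) / 2) = (k ! : ℕ) := by
    rw [← Real.Gamma_nat_eq_factorial]; congr 1; ring
  rw [hG] at h
  have hI : ∫ z : ℂ, 1 / Real.pi * Real.exp (-‖z‖ ^ 2) * ‖z‖ ^ (2 * k) = (k ! : ℕ) := by
    have : ∀ z : ℂ, 1 / Real.pi * Real.exp (-‖z‖ ^ 2) * ‖z‖ ^ (2 * k) =
        1 / Real.pi * (‖z‖ ^ (2 * (k : ℝ)) * Real.exp (-‖z‖ ^ (2 : ℝ))) := by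
      intro z
      rw [Real.rpow_two, show (2 * (k : ℝ)) = ((2 * k : ℕ) : ℝ) by push_cast; rfl,
        Real.rpow_natCast]
      ring
    simp_rw [this]
    rw [integral_const_mul, h]
    field_simp
  have hint : Integrable fun z : ℂ => 1 / Real.pi * Real.exp (-‖z‖ ^ 2) * ‖z‖ ^ (2 * k) := by
    -- A function that is not integrable has integral `0` by convention.
    by_contra hc
    rw [integral_undef hc] at hI
    exact (Nat.cast_ne_zero.2 (Nat.factorial_ne_zero k)) hI.symm
  rw [stdComplexGaussian, lintegral_withDensity_eq_lintegral_mul _ (by fun_prop) (by fun_prop),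
    ← hI, ofReal_integral_eq_lintegral_ofReal hint (ae_of_all _ fun z => by positivity)]
  refine lintegral_congr fun z => ?_
  rw [Pi.mul_apply, ← ENNReal.ofReal_mul (by positivity)]

theorem integrable_norm_pow_stdComplexGaussian (k : ℕ) :
    Integrable (fun z : ℂ => ‖z‖ ^ (2 * k)) stdComplexGaussian := by
  refine ⟨by fun_prop, ?_⟩
  rw [hasFiniteIntegral_iff_ofReal (ae_of_all _ fun z => by positivity),
    lintegral_norm_pow_stdComplexGaussian]
  exact ENNReal.ofReal_lt_top

theorem integral_norm_pow_stdComplexGaussian (k : ℕ) :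
    ∫ z, ‖z‖ ^ (2 * k) ∂stdComplexGaussian = (k ! : ℕ) := by
  rw [integral_eq_lintegral_of_nonneg_ae (ae_of_all _ fun z => by positivity) (by fun_prop),
    lintegral_norm_pow_stdComplexGaussian, ENNReal.toReal_ofReal (by positivity)]

theorem lintegral_neg_stdComplexGaussian (f : ℂ → ℝ≥0∞) (hf : Measurable f) :
    ∫⁻ z, f (-z) ∂stdComplexGaussian = ∫⁻ z, f z ∂stdComplexGaussian := by
  rw [stdComplexGaussian, lintegral_withDensity_eq_lintegral_mul _ (by fun_prop) (by fun_prop),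
    lintegral_withDensity_eq_lintegral_mul _ (by fun_prop) hf]
  have := lintegral_neg_eq_self (μ := (volume : Measure ℂ)) (fun z : ℂ =>
    ENNReal.ofReal (1 / Real.pi * Real.exp (-‖z‖ ^ 2)) * f z)
  rw [← lintegral_neg_eq_self]
  refine lintegral_congr fun z => ?_
  simp

theorem stdComplexGaussian_pos_of_isOpen {U : Set ℂ} (hU : IsOpen U) (hne : U.Nonempty) :
    0 < stdComplexGaussian U := by
  have hac : (volume : Measure ℂ) ≪ stdComplexGaussian :=
    withDensity_absolutelyContinuous' (by fun_prop)
      (ae_of_all _ fun z => (ENNReal.ofReal_pos.2 (by positivity)).ne')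
  exact pos_iff_ne_zero.2 fun h => (hU.measure_pos volume hne).ne' (hac h)

/-- Averaging over `z ↦ -z` removes the odd part of `‖a + c z‖²`. -/
theorem lintegral_norm_add_sq_le (a : ℂ) (c : ℝ) :
    ∫⁻ z, ENNReal.ofReal (‖a + c * z‖ ^ 2) ∂stdComplexGaussian ≤
      ENNReal.ofReal (‖a‖ ^ 2 + c ^ 2) := by
  have h2 := integrable_norm_pow_stdComplexGaussian 1
  have i2 := integral_norm_pow_stdComplexGaussian 1
  simp only [mul_one, Nat.factorial_one, Nat.cast_one] at h2 i2
  have hint : Integrable (fun z : ℂ => 2 * ‖a‖ ^ 2 + 2 * c ^ 2 * ‖z‖ ^ 2) stdComplexGaussian :=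
    (integrable_const _).add (h2.const_mul _)
  have hI : ∫ z, (2 * ‖a‖ ^ 2 + 2 * c ^ 2 * ‖z‖ ^ 2) ∂stdComplexGaussian =
      2 * (‖a‖ ^ 2 + c ^ 2) := by
    rw [integral_add (integrable_const _) (h2.const_mul _), integral_const_mul (2 * c ^ 2), i2]
    simp; ring
  have key : 2 * ∫⁻ z, ENNReal.ofReal (‖a + c * z‖ ^ 2) ∂stdComplexGaussian ≤
      2 * ENNReal.ofReal (‖a‖ ^ 2 + c ^ 2) := by
    have e2 : (2 : ℝ≥0∞) = ENNReal.ofReal 2 := by simp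
    rw [two_mul]
    nth_rewrite 2 [← lintegral_neg_stdComplexGaussian _ (by fun_prop)]
    rw [← lintegral_add_left (by fun_prop), e2, ← ENNReal.ofReal_mul (by norm_num), ← hI,
      ofReal_integral_eq_lintegral_ofReal hint (ae_of_all _ fun z => by positivity)]
    refine lintegral_mono fun z => ?_
    rw [← ENNReal.ofReal_add (by positivity) (by positivity)]
    refine ENNReal.ofReal_le_ofReal (le_of_eq ?_)
    have := parallelogram_law_with_norm ℝ a (c * z)
    rw [mul_neg, ← sub_eq_add_neg]
    have hn : ‖(c : ℂ) * z‖ ^ 2 = c ^ 2 * ‖z‖ ^ 2 := by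
      rw [norm_mul, mul_pow, Complex.norm_real, Real.norm_eq_abs, sq_abs]
    linear_combination this + 2 * hn
  exact (ENNReal.mul_le_mul_iff_right (by norm_num) (by norm_num)).1 key

theorem norm_add_pow_four_add_norm_sub_pow_four_le (a b : ℂ) :
    ‖a + b‖ ^ 4 + ‖a - b‖ ^ 4 ≤ 2 * ‖a‖ ^ 4 + 12 * ‖a‖ ^ 2 * ‖b‖ ^ 2 + 2 * ‖b‖ ^ 4 := by
  have h1 := norm_add_sq_real a b
  have h2 := norm_sub_sq_real a b
  have h3 : inner ℝ a b ^ 2 ≤ ‖a‖ ^ 2 * ‖b‖ ^ 2 := by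
    rw [← mul_pow]
    exact sq_le_sq' (neg_le_of_abs_le (abs_real_inner_le_norm a b)) (real_inner_le_norm a b)
  have h4 : ‖a + b‖ ^ 4 = (‖a + b‖ ^ 2) ^ 2 := by ring
  have h5 : ‖a - b‖ ^ 4 = (‖a - b‖ ^ 2) ^ 2 := by ring
  rw [h4, h5, h1, h2]
  nlinarith

/-- Averaging over `z ↦ -z` removes the odd part of `‖a + c z‖⁴`. -/
theorem lintegral_norm_add_pow_four_le (a : ℂ) (c : ℝ) :
    ∫⁻ z, ENNReal.ofReal (‖a + c * z‖ ^ 4) ∂stdComplexGaussian ≤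
      ENNReal.ofReal (‖a‖ ^ 4 + 6 * c ^ 2 * ‖a‖ ^ 2 + 2 * c ^ 4) := by
  have h2 := integrable_norm_pow_stdComplexGaussian 1
  have i2 := integral_norm_pow_stdComplexGaussian 1
  have h4 := integrable_norm_pow_stdComplexGaussian 2
  have i4 := integral_norm_pow_stdComplexGaussian 2
  simp only [mul_one, Nat.factorial_one, Nat.factorial_two, Nat.cast_one,
    Nat.reduceMul] at h2 i2 h4 i4
  have hint : Integrable (fun z : ℂ => 2 * ‖a‖ ^ 4 + 12 * ‖a‖ ^ 2 * c ^ 2 * ‖z‖ ^ 2 +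
      2 * c ^ 4 * ‖z‖ ^ 4) stdComplexGaussian :=
    ((integrable_const _).add (h2.const_mul _)).add (h4.const_mul _)
  have hI : ∫ z, (2 * ‖a‖ ^ 4 + 12 * ‖a‖ ^ 2 * c ^ 2 * ‖z‖ ^ 2 + 2 * c ^ 4 * ‖z‖ ^ 4)
      ∂stdComplexGaussian = 2 * (‖a‖ ^ 4 + 6 * c ^ 2 * ‖a‖ ^ 2 + 2 * c ^ 4) := by
    have h12 : Integrable (fun z : ℂ => 2 * ‖a‖ ^ 4 + 12 * ‖a‖ ^ 2 * c ^ 2 * ‖z‖ ^ 2)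
        stdComplexGaussian := (integrable_const _).add (h2.const_mul _)
    rw [integral_add h12 (h4.const_mul _), integral_add (integrable_const _) (h2.const_mul _),
      integral_const_mul (12 * ‖a‖ ^ 2 * c ^ 2), integral_const_mul (2 * c ^ 4), i2, i4]
    simp; ring
  have key : 2 * ∫⁻ z, ENNReal.ofReal (‖a + c * z‖ ^ 4) ∂stdComplexGaussian ≤
      2 * ENNReal.ofReal (‖a‖ ^ 4 + 6 * c ^ 2 * ‖a‖ ^ 2 + 2 * c ^ 4) := by
    have e2 : (2 : ℝ≥0∞) = ENNReal.ofReal 2 := by simp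
    rw [two_mul]
    nth_rewrite 2 [← lintegral_neg_stdComplexGaussian _ (by fun_prop)]
    rw [← lintegral_add_left (by fun_prop), e2, ← ENNReal.ofReal_mul (by norm_num), ← hI,
      ofReal_integral_eq_lintegral_ofReal hint (ae_of_all _ fun z => by positivity)]
    refine lintegral_mono fun z => ?_
    rw [← ENNReal.ofReal_add (by positivity) (by positivity)]
    refine ENNReal.ofReal_le_ofReal ?_
    have := norm_add_pow_four_add_norm_sub_pow_four_le a (c * z)
    rw [mul_neg, ← sub_eq_add_neg]
    have hn : ‖(c : ℂ) * z‖ ^ 2 = c ^ 2 * ‖z‖ ^ 2 := by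
      rw [norm_mul, mul_pow, Complex.norm_real, Real.norm_eq_abs, sq_abs]
    have hn4 : ‖(c : ℂ) * z‖ ^ 4 = c ^ 4 * ‖z‖ ^ 4 := by
      calc _ = (‖(c : ℂ) * z‖ ^ 2) ^ 2 := by ring
        _ = _ := by rw [hn]; ring
    rw [hn, hn4] at this
    linarith
  exact (ENNReal.mul_le_mul_iff_right (by norm_num) (by norm_num)).1 key

/-! ### Gaussian sums -/

instance : IsProbabilityMeasure gaussianSeq := by unfold gaussianSeq; infer_instance

theorem iIndepFun_eval_gaussianSeq :
    ProbabilityTheory.iIndepFun (fun (n : ℕ) (g : ℕ → ℂ) => g n) gaussianSeq :=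
  ProbabilityTheory.iIndepFun_infinitePi (X := fun _ z => z) (fun _ => measurable_id)

theorem map_eval_gaussianSeq (n : ℕ) :
    gaussianSeq.map (fun g : ℕ → ℂ => g n) = stdComplexGaussian :=
  Measure.infinitePi_map_eval _ n

theorem lintegral_eval_gaussianSeq (n : ℕ) {f : ℂ → ℝ≥0∞} (hf : Measurable f) :
    ∫⁻ g, f (g n) ∂gaussianSeq = ∫⁻ z, f z ∂stdComplexGaussian := by
  rw [← map_eval_gaussianSeq n, lintegral_map hf (measurable_pi_apply n)]

/-- Tonelli's theorem for a function of a finite partial sum and of the next coordinate. -/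
theorem lintegral_sum_and_eval (a : ℕ → ℝ) (n : ℕ) {F : ℂ → ℂ → ℝ≥0∞}
    (hF : Measurable (Function.uncurry F)) :
    ∫⁻ g, F (∑ i ∈ Finset.range n, a i * g i) (g n) ∂gaussianSeq =
      ∫⁻ g, ∫⁻ z, F (∑ i ∈ Finset.range n, a i * g i) z ∂stdComplexGaussian ∂gaussianSeq := by
  have hm : Measurable fun g : ℕ → ℂ => ∑ i ∈ Finset.range n, (a i : ℂ) * g i := by fun_prop
  have hi : ProbabilityTheory.IndepFun (fun g : ℕ → ℂ => ∑ i ∈ Finset.range n, (a i : ℂ) * g i)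
      (fun g => g n) gaussianSeq := by
    have h := iIndepFun_eval_gaussianSeq.indepFun_finset (Finset.range n) {n}
      (by simp) (fun i => measurable_pi_apply i)
    have h1 := h.comp
      (by fun_prop : Measurable fun v : (Finset.range n) → ℂ =>
        ∑ i : Finset.range n, (a i : ℂ) * v i)
      (measurable_pi_apply (⟨n, by simp⟩ : ({n} : Finset ℕ)))
    convert! h1 using 1
    funext g
    simp only [Function.comp]
    exact (Finset.sum_coe_sort (Finset.range n) fun i => (a i : ℂ) * g i).symm
  have hmap := hi.map_prod_eq_prod_map_map hm.aemeasurable (measurable_pi_apply n).aemeasurable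
  rw [map_eval_gaussianSeq] at hmap
  have e1 : ∫⁻ g, F (∑ i ∈ Finset.range n, a i * g i) (g n) ∂gaussianSeq =
      ∫⁻ p, Function.uncurry F p ∂(gaussianSeq.map
        fun g => (∑ i ∈ Finset.range n, (a i : ℂ) * g i, g n)) := by
    rw [lintegral_map hF (hm.prodMk (measurable_pi_apply n))]
    rfl
  rw [e1, hmap, lintegral_prod _ hF.aemeasurable, lintegral_map hF.lintegral_prod_right' hm]
  rfl

theorem lintegral_norm_gaussian_sum_sq_le (a : ℕ → ℝ) (n : ℕ) :
    ∫⁻ g, ENNReal.ofReal (‖∑ i ∈ Finset.range n, a i * g i‖ ^ 2) ∂gaussianSeq ≤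
      ENNReal.ofReal (∑ i ∈ Finset.range n, a i ^ 2) := by
  induction n with
  | zero => simp
  | succ n ih =>
    simp_rw [Finset.sum_range_succ]
    rw [lintegral_sum_and_eval a n (F := fun s z => ENNReal.ofReal (‖s + a n * z‖ ^ 2))
      (by fun_prop)]
    calc _ ≤ ∫⁻ g, (ENNReal.ofReal (‖∑ i ∈ Finset.range n, a i * g i‖ ^ 2) +
          ENNReal.ofReal (a n ^ 2)) ∂gaussianSeq := by
          refine lintegral_mono fun g => (lintegral_norm_add_sq_le _ _).trans ?_
          rw [ENNReal.ofReal_add (by positivity) (by positivity)]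
      _ ≤ _ := by
        rw [lintegral_add_right _ measurable_const, lintegral_const, measure_univ, mul_one,
          ENNReal.ofReal_add (Finset.sum_nonneg fun i _ => sq_nonneg _) (sq_nonneg _)]
        gcongr

/-- The fourth moment of a Gaussian sum is controlled by the square of its variance. -/
theorem lintegral_norm_gaussian_sum_pow_four_le (a : ℕ → ℝ) (n : ℕ) :
    ∫⁻ g, ENNReal.ofReal (‖∑ i ∈ Finset.range n, a i * g i‖ ^ 4) ∂gaussianSeq ≤
      ENNReal.ofReal (3 * (∑ i ∈ Finset.range n, a i ^ 2) ^ 2) := by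
  induction n with
  | zero => simp
  | succ n ih =>
    have h2 := lintegral_norm_gaussian_sum_sq_le a n
    have hs : 0 ≤ ∑ i ∈ Finset.range n, a i ^ 2 := Finset.sum_nonneg fun i _ => sq_nonneg _
    simp_rw [Finset.sum_range_succ]
    rw [lintegral_sum_and_eval a n (F := fun s z => ENNReal.ofReal (‖s + a n * z‖ ^ 4))
      (by fun_prop)]
    calc _ ≤ ∫⁻ g, (ENNReal.ofReal (‖∑ i ∈ Finset.range n, a i * g i‖ ^ 4) +
          (ENNReal.ofReal (6 * a n ^ 2) *
            ENNReal.ofReal (‖∑ i ∈ Finset.range n, a i * g i‖ ^ 2) +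
          ENNReal.ofReal (2 * a n ^ 4))) ∂gaussianSeq := by
          refine lintegral_mono fun g => (lintegral_norm_add_pow_four_le _ _).trans ?_
          rw [add_assoc, ENNReal.ofReal_add (by positivity) (by positivity),
            ENNReal.ofReal_add (by positivity) (by positivity),
            ENNReal.ofReal_mul (by positivity)]
      _ ≤ ENNReal.ofReal (3 * (∑ i ∈ Finset.range n, a i ^ 2) ^ 2) +
          (ENNReal.ofReal (6 * a n ^ 2) * ENNReal.ofReal (∑ i ∈ Finset.range n, a i ^ 2) +
            ENNReal.ofReal (2 * a n ^ 4)) := by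
        rw [lintegral_add_left (by fun_prop), lintegral_add_right _ measurable_const,
          lintegral_const, measure_univ, mul_one, lintegral_const_mul _ (by fun_prop)]
        gcongr
      _ ≤ _ := by
        rw [← ENNReal.ofReal_mul (by positivity), ← ENNReal.ofReal_add (by positivity)
          (by positivity), ← ENNReal.ofReal_add (by positivity) (by positivity)]
        refine ENNReal.ofReal_le_ofReal ?_
        nlinarith [sq_nonneg (a n ^ 2)]

/-! ### The random series -/

/-- The harmonic oscillator `-d²/dx² + x²` on complex Schwartz functions. -/
noncomputable def harmonicOsc : 𝓢(ℝ, ℂ) →L[ℂ] 𝓢(ℝ, ℂ) :=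
  SchwartzMap.smulLeftCLM ℂ (fun x : ℝ => (x : ℂ) ^ 2) -
    (SchwartzMap.derivCLM ℂ ℂ).comp (SchwartzMap.derivCLM ℂ ℂ)

theorem hasTemperateGrowth_ofReal_sq :
    Function.HasTemperateGrowth fun x : ℝ => (x : ℂ) ^ 2 := by
  have h : Function.HasTemperateGrowth fun x : ℝ => (x : ℂ) :=
    Complex.ofRealCLM.hasTemperateGrowth
  exact h.pow 2

theorem harmonicOsc_apply (f : 𝓢(ℝ, ℂ)) (x : ℝ) :
    harmonicOsc f x = (x : ℂ) ^ 2 * f x - deriv (deriv f) x := by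
  have h := SchwartzMap.smulLeftCLM_apply_apply hasTemperateGrowth_ofReal_sq f x
  change SchwartzMap.smulLeftCLM ℂ (fun x : ℝ => (x : ℂ) ^ 2) f x - _ = _
  rw [h]
  rfl

theorem harmonicOsc_hermiteSchwartz (n : ℕ) (x : ℝ) :
    harmonicOsc (hermiteSchwartz n) x = (freq n : ℂ) ^ 2 * hermiteFun n x := by
  have h1 : ∀ y : ℝ,
      HasDerivAt (⇑(hermiteSchwartz n)) ((deriv (hermiteFun n) y : ℝ) : ℂ) y := fun y =>
    ((hermiteSchwartzReal n).hasDerivAt y).ofReal_comp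
  have h2 : ∀ y : ℝ, HasDerivAt (fun y : ℝ => ((deriv (hermiteFun n) y : ℝ) : ℂ))
      ((deriv (deriv (hermiteFun n)) y : ℝ) : ℂ) y := fun y =>
    ((SchwartzMap.derivCLM ℝ ℝ (hermiteSchwartzReal n)).hasDerivAt y).ofReal_comp
  have h3 : deriv (⇑(hermiteSchwartz n)) = fun y : ℝ => ((deriv (hermiteFun n) y : ℝ) : ℂ) :=
    funext fun y => (h1 y).deriv
  rw [harmonicOsc_apply, h3, (h2 x).deriv, deriv_deriv_hermiteFun, hermiteSchwartz_apply]
  push_cast; ring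

theorem schwartzMap_integrable_mul_complex (f g : 𝓢(ℝ, ℂ)) : Integrable fun x => f x * g x :=
  (SchwartzMap.pairing (ContinuousLinearMap.mul ℝ ℂ) f g).integrable

/-- The harmonic oscillator is symmetric. -/
theorem integral_harmonicOsc_mul (f g : 𝓢(ℝ, ℂ)) :
    ∫ x, harmonicOsc f x * g x = ∫ x, f x * harmonicOsc g x := by
  have h1 := SchwartzMap.integral_mul_deriv_eq_neg_deriv_mul g (SchwartzMap.derivCLM ℂ ℂ f)
  have h2 := SchwartzMap.integral_mul_deriv_eq_neg_deriv_mul f (SchwartzMap.derivCLM ℂ ℂ g)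
  have i1 : Integrable fun x : ℝ => (x : ℂ) ^ 2 * f x * g x := by
    have := schwartzMap_integrable_mul_complex
      (SchwartzMap.smulLeftCLM ℂ (fun x : ℝ => (x : ℂ) ^ 2) f) g
    simpa only [SchwartzMap.smulLeftCLM_apply_apply hasTemperateGrowth_ofReal_sq, smul_eq_mul]
      using this
  have i2 : Integrable fun x : ℝ => g x * deriv (SchwartzMap.derivCLM ℂ ℂ f) x :=
    schwartzMap_integrable_mul_complex g
      (SchwartzMap.derivCLM ℂ ℂ (SchwartzMap.derivCLM ℂ ℂ f))
  have i3 : Integrable fun x : ℝ => f x * deriv (SchwartzMap.derivCLM ℂ ℂ g) x :=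
    schwartzMap_integrable_mul_complex f
      (SchwartzMap.derivCLM ℂ ℂ (SchwartzMap.derivCLM ℂ ℂ g))
  have e1 : ∀ x, harmonicOsc f x * g x =
      (x : ℂ) ^ 2 * f x * g x - g x * deriv (SchwartzMap.derivCLM ℂ ℂ f) x := fun x => by
    rw [harmonicOsc_apply, show (⇑(SchwartzMap.derivCLM ℂ ℂ f)) = deriv f from rfl]; ring
  have e2 : ∀ x, f x * harmonicOsc g x =
      (x : ℂ) ^ 2 * f x * g x - f x * deriv (SchwartzMap.derivCLM ℂ ℂ g) x := fun x => by
    rw [harmonicOsc_apply, show (⇑(SchwartzMap.derivCLM ℂ ℂ g)) = deriv g from rfl]; ring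
  simp_rw [e1, e2]
  rw [integral_sub i1 i2, integral_sub i1 i3, h1, h2]
  congr 2
  refine integral_congr_ae (Eventually.of_forall fun x => ?_)
  simp only [SchwartzMap.derivCLM_apply]
  ring

theorem toTemperedDistribution_hermite_apply (n : ℕ) (f : 𝓢(ℝ, ℂ)) :
    SchwartzMap.toTemperedDistributionCLM ℝ ℂ volume (hermiteSchwartz n) f =
      ∫ x, f x * hermiteFun n x :=
  SchwartzMap.toTemperedDistributionCLM_apply_apply volume (hermiteSchwartz n) f

/-- The transpose of the harmonic oscillator, from `L²` to tempered distributions. It maps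
`λ_n⁻² h_n` to `h_n`, so it turns convergence in `L²` into convergence of Hermite series with
coefficients that grow. -/
noncomputable def oscTranspose : Lp ℂ 2 (volume : Measure ℝ) →L[ℂ] 𝓢'(ℝ, ℂ) :=
  (PointwiseConvergenceCLM.precomp ℂ harmonicOsc).comp
    (Lp.toTemperedDistributionCLM ℂ volume 2)

theorem oscTranspose_toLp_hermite (n : ℕ) :
    oscTranspose ((hermiteSchwartz n).toLp 2) =
      ((freq n : ℂ) ^ 2) •
        SchwartzMap.toTemperedDistributionCLM ℝ ℂ volume (hermiteSchwartz n) := by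
  ext f
  have h1 : oscTranspose ((hermiteSchwartz n).toLp 2) f =
      SchwartzMap.toTemperedDistributionCLM ℝ ℂ volume (hermiteSchwartz n) (harmonicOsc f) := by
    rw [← Lp.toTemperedDistribution_toLp_eq (p := 2)]; rfl
  have h2 : (((freq n : ℂ) ^ 2) •
      SchwartzMap.toTemperedDistributionCLM ℝ ℂ volume (hermiteSchwartz n)) f =
      (freq n : ℂ) ^ 2 * SchwartzMap.toTemperedDistributionCLM ℝ ℂ volume (hermiteSchwartz n) f :=
    rfl
  rw [h1, h2, toTemperedDistribution_hermite_apply, toTemperedDistribution_hermite_apply,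
    ← integral_const_mul]
  refine (integral_harmonicOsc_mul f (hermiteSchwartz n)).trans ?_
  congr 1; funext x
  rw [harmonicOsc_hermiteSchwartz]; ring

theorem coeff_hermite (n m : ℕ) :
    coeff (SchwartzMap.toTemperedDistributionCLM ℝ ℂ volume (hermiteSchwartz n)) m =
      if n = m then 1 else 0 := by
  rw [coeff, toTemperedDistribution_hermite_apply]
  simp only [hermiteSchwartz_apply]
  have : ∀ x, (hermiteFun m x : ℂ) * hermiteFun n x = ((hermiteFun n x * hermiteFun m x : ℝ) : ℂ) :=
    fun x => by push_cast; ring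
  simp_rw [this]
  rw [integral_complex_ofReal, integral_hermiteFun_mul]
  split_ifs <;> simp

theorem norm_toLp_hermite (n : ℕ) : ‖(hermiteSchwartz n).toLp 2 (volume : Measure ℝ)‖ = 1 := by
  have h := SchwartzMap.inner_toL2_toL2_eq (hermiteSchwartz n) (hermiteSchwartz n) volume
  have h1 : ∫ x, inner ℂ (hermiteSchwartz n x) (hermiteSchwartz n x) = 1 := by
    have : ∀ x, inner ℂ (hermiteSchwartz n x) (hermiteSchwartz n x) =
        ((hermiteFun n x * hermiteFun n x : ℝ) : ℂ) := fun x => by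
      rw [hermiteSchwartz_apply, RCLike.inner_apply]; simp
    simp_rw [this]
    rw [integral_complex_ofReal, integral_hermiteFun_mul]; simp
  rw [h1, inner_self_eq_norm_sq_to_K] at h
  have h2 : ‖(hermiteSchwartz n).toLp 2 (volume : Measure ℝ)‖ ^ 2 = 1 :=
    Complex.ofReal_injective (by push_cast; exact h)
  exact (pow_eq_one_iff_of_nonneg (norm_nonneg _) two_ne_zero).1 h2

/-- A Hermite series converges in the space of tempered distributions as soon as
`∑ |a_n| / λ_n²` does. -/
theorem summable_hermite_series {a : ℕ → ℂ} (ha : Summable fun n => ‖a n‖ / freq n ^ 2) :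
    Summable fun n => a n •
      SchwartzMap.toTemperedDistributionCLM ℝ ℂ volume (hermiteSchwartz n) := by
  have h1 : Summable fun n => (a n / (freq n : ℂ) ^ 2) •
      (hermiteSchwartz n).toLp 2 (volume : Measure ℝ) := by
    refine Summable.of_norm ?_
    simp_rw [norm_smul, norm_toLp_hermite, norm_div, norm_pow, Complex.norm_real, Real.norm_eq_abs,
      sq_abs, mul_one]
    exact ha
  have h2 := h1.mapL oscTranspose
  refine h2.congr fun n => ?_
  have hn : (freq n : ℂ) ≠ 0 := by exact_mod_cast (freq_pos n).ne'
  rw [map_smul, oscTranspose_toLp_hermite, smul_smul]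
  congr 1
  field_simp

theorem coeff_tsum_hermite {a : ℕ → ℂ} (ha : Summable fun n => ‖a n‖ / freq n ^ 2) (m : ℕ) :
    coeff (∑' n, a n • SchwartzMap.toTemperedDistributionCLM ℝ ℂ volume (hermiteSchwartz n)) m =
      a m := by
  have h := (summable_hermite_series ha).hasSum.mapL
    (PointwiseConvergenceCLM.evalCLM (RingHom.id ℂ) ℂ (hermiteSchwartz m))
  have h2 : HasSum (fun n => if n = m then a m else 0) (a m) := hasSum_ite_eq m (a m)
  refine h.unique (h2.congr_fun fun n => ?_)
  change coeff (a n • SchwartzMap.toTemperedDistributionCLM ℝ ℂ volume (hermiteSchwartz n)) m = _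
  rw [coeff_smul, coeff_hermite]
  split_ifs with hnm
  · rw [hnm, mul_one]
  · rw [mul_zero]

/-- Almost surely a Gaussian sequence is square summable against any summable weight. -/
theorem ae_summable_mul_norm_sq {w : ℕ → ℝ} (hw0 : ∀ n, 0 ≤ w n) (hw : Summable w) :
    ∀ᵐ g ∂gaussianSeq, Summable fun n => w n * ‖g n‖ ^ 2 := by
  have hm : ∀ n, Measurable fun g : ℕ → ℂ => ENNReal.ofReal (w n * ‖g n‖ ^ 2) := by fun_prop
  have h1 : ∫⁻ g, ∑' n, ENNReal.ofReal (w n * ‖g n‖ ^ 2) ∂gaussianSeq ≠ ⊤ := by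
    rw [lintegral_tsum fun n => (hm n).aemeasurable]
    have : ∀ n, ∫⁻ g, ENNReal.ofReal (w n * ‖g n‖ ^ 2) ∂gaussianSeq = ENNReal.ofReal (w n) := by
      intro n
      rw [lintegral_eval_gaussianSeq n (f := fun z => ENNReal.ofReal (w n * ‖z‖ ^ 2))
        (by fun_prop)]
      simp_rw [ENNReal.ofReal_mul (hw0 n)]
      rw [lintegral_const_mul _ (by fun_prop)]
      have := lintegral_norm_pow_stdComplexGaussian 1
      simp only [mul_one] at this
      rw [this]
      simp
    simp_rw [this]
    rw [← ENNReal.ofReal_tsum_of_nonneg hw0 hw]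
    exact ENNReal.ofReal_ne_top
  filter_upwards [ae_lt_top' (AEMeasurable.tsum fun n => (hm n).aemeasurable) h1] with g hg
  have := ENNReal.summable_toReal hg.ne
  refine this.congr fun n => ?_
  rw [ENNReal.toReal_ofReal (mul_nonneg (hw0 n) (sq_nonneg _))]

theorem summable_freq_rpow {t : ℝ} (ht : 2 < t) : Summable fun n => freq n ^ (-t) := by
  have h : Summable fun n : ℕ => ((n : ℝ) + 1) ^ (-(t / 2)) := by
    have h0 : Summable fun n : ℕ => (n : ℝ) ^ (-(t / 2)) :=
      Real.summable_nat_rpow.2 (by linarith)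
    have := (summable_nat_add_iff 1).2 h0
    simpa using this
  refine Summable.of_nonneg_of_le (fun n => Real.rpow_nonneg (freq_pos n).le _) (fun n => ?_) h
  have h1 : freq n ^ (-t) = (2 * (n : ℝ) + 1) ^ (-(t / 2)) := by
    rw [freq, Real.sqrt_eq_rpow, ← Real.rpow_mul (by positivity)]; ring_nf
  rw [h1]
  exact Real.rpow_le_rpow_of_nonpos (by positivity)
    (by linarith [(Nat.cast_nonneg n : (0 : ℝ) ≤ n)]) (by linarith)

/-- Almost surely the random series converges in `𝓢'` and has the expected coefficients. -/
theorem ae_coeff_randomSeries :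
    ∀ᵐ g ∂gaussianSeq, ∀ n, coeff (randomSeries g) n = ((√2 / freq n : ℝ) : ℂ) * g n := by
  have hw : Summable fun n => freq n ^ (-(3 : ℝ)) := summable_freq_rpow (by norm_num)
  have hw0 : ∀ n, 0 ≤ freq n ^ (-(3 : ℝ)) := fun n => Real.rpow_nonneg (freq_pos n).le _
  filter_upwards [ae_summable_mul_norm_sq hw0 hw] with g hg n
  refine coeff_tsum_hermite (a := fun n => ((√2 / freq n : ℝ) : ℂ) * g n) ?_ n
  refine Summable.of_nonneg_of_le (fun n => by positivity) (fun n => ?_)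
    ((hw.add hg).mul_left √2)
  have hf := freq_pos n
  have h3 : freq n ^ (-(3 : ℝ)) = (freq n ^ 3)⁻¹ := by
    rw [Real.rpow_neg hf.le]; norm_cast
  rw [h3, norm_mul, Complex.norm_real, Real.norm_of_nonneg (by positivity)]
  have h4 : √2 / freq n * ‖g n‖ / freq n ^ 2 = √2 * ((freq n ^ 3)⁻¹ * ‖g n‖) := by
    field_simp
  rw [h4]
  have h5 : ‖g n‖ ≤ 1 + ‖g n‖ ^ 2 := by nlinarith [sq_nonneg (‖g n‖ - 1)]
  have h6 : 0 < (freq n ^ 3)⁻¹ := by positivity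
  have : (freq n ^ 3)⁻¹ * ‖g n‖ ≤ (freq n ^ 3)⁻¹ + (freq n ^ 3)⁻¹ * ‖g n‖ ^ 2 := by nlinarith
  gcongr

/-- The weight `2 λ_n^{-2σ-2}` of the `n`-th Gaussian in the squared norm of `ℋ^{-σ}`. -/
noncomputable def normWeight (σ : ℝ) (n : ℕ) : ℝ := freq n ^ (2 * -σ) * (2 / freq n ^ 2)

theorem normWeight_nonneg (σ : ℝ) (n : ℕ) : 0 ≤ normWeight σ n :=
  mul_nonneg (Real.rpow_nonneg (freq_pos n).le _) (by positivity)

theorem summable_normWeight {σ : ℝ} (hσ : 0 < σ) : Summable (normWeight σ) := by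
  refine ((summable_freq_rpow (t := 2 * σ + 2) (by linarith)).mul_left 2).congr fun n => ?_
  have hf := freq_pos n
  rw [normWeight, show -(2 * σ + 2) = 2 * -σ + -2 by ring, Real.rpow_add hf, Real.rpow_neg hf.le 2,
    Real.rpow_two]
  ring

theorem weighted_norm_sq_eq (σ : ℝ) (n : ℕ) (z : ℂ) :
    freq n ^ (2 * -σ) * ‖((√2 / freq n : ℝ) : ℂ) * z‖ ^ 2 = normWeight σ n * ‖z‖ ^ 2 := by
  rw [norm_mul, mul_pow, Complex.norm_real, Real.norm_eq_abs, sq_abs, div_pow,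
    Real.sq_sqrt zero_le_two, normWeight]
  ring

/-- Almost surely `randomElement` is the random series, in terms of its coefficients. -/
theorem ae_coeff_randomElement {σ : ℝ} (hσ : 0 < σ) :
    ∀ᵐ g ∂gaussianSeq, ∀ n,
      coeff (randomElement (-σ) g).toDistr n = ((√2 / freq n : ℝ) : ℂ) * g n := by
  filter_upwards [ae_coeff_randomSeries,
    ae_summable_mul_norm_sq (normWeight_nonneg σ) (summable_normWeight hσ)] with g h1 h2
  have h : randomSeries g ∈ sobolevSubmodule (-σ) := by
    change Summable fun n => freq n ^ (2 * -σ) * ‖coeff (randomSeries g) n‖ ^ 2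
    refine h2.congr fun n => ?_
    rw [h1, weighted_norm_sq_eq]
  have h3 : (randomElement (-σ) g).toDistr = randomSeries g := by
    have h4 : randomElement (-σ) g = (⟨randomSeries g, h⟩ : sobolevSubmodule (-σ)) := dif_pos h
    rw [h4]; rfl
  rw [h3]
  exact h1

theorem isInducing_toLp (s : ℝ) : IsInducing (HSpace.toLp s) := ⟨rfl⟩

theorem continuous_coeff {s : ℝ} (n : ℕ) : Continuous fun u : HSpace s => coeff u.toDistr n := by
  have h1 : Continuous fun u : HSpace s => (HSpace.toLp s u) n :=
    (lp.evalCLM ℂ (fun _ : ℕ => ℂ) 2 n).continuous.comp (isInducing_toLp s).continuous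
  have h2 : (fun u : HSpace s => coeff u.toDistr n) =
      fun u : HSpace s => ((freq n ^ s : ℝ) : ℂ)⁻¹ * (HSpace.toLp s u) n := by
    funext u
    have : ((freq n ^ s : ℝ) : ℂ) ≠ 0 := by
      exact_mod_cast (Real.rpow_pos_of_pos (freq_pos n) s).ne'
    change _ = _ * (_ * _)
    rw [inv_mul_cancel_left₀ this]
  rw [h2]
  exact continuous_const.mul h1

theorem hermite_mem_sobolevSubmodule (s : ℝ) (n : ℕ) :
    SchwartzMap.toTemperedDistributionCLM ℝ ℂ volume (hermiteSchwartz n) ∈ sobolevSubmodule s := by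
  refine summable_of_ne_finset_zero (s := {n}) fun m hm => ?_
  rw [coeff_hermite, if_neg (by simpa [eq_comm] using hm)]
  simp

/-- The Hermite function `h_n` as an element of `ℋ^s`. -/
noncomputable def hermiteElement (s : ℝ) (n : ℕ) : HSpace s :=
  (⟨_, hermite_mem_sobolevSubmodule s n⟩ : sobolevSubmodule s)

theorem toLp_smul_hermiteElement (s : ℝ) (n : ℕ) (c : ℂ) :
    HSpace.toLp s (c • hermiteElement s n) = lp.single 2 n (((freq n ^ s : ℝ) : ℂ) * c) := by
  ext m
  have h : HSpace.toLp s (c • hermiteElement s n) m =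
    ((freq m ^ s : ℝ) : ℂ) * (c * coeff
      (SchwartzMap.toTemperedDistributionCLM ℝ ℂ volume (hermiteSchwartz n)) m) := rfl
  rw [h, coeff_hermite, lp.single_apply]
  by_cases hnm : n = m
  · subst hnm; simp
  · rw [if_neg hnm, Pi.single_eq_of_ne (Ne.symm hnm)]; simp

theorem aemeasurable_randomElement {σ : ℝ} (hσ : 0 < σ) :
    AEMeasurable (randomElement (-σ)) gaussianSeq := by
  -- The partial sums are continuous in `g`, and converge almost surely in `ℋ^{-σ}`.
  refine aemeasurable_of_tendsto_metrizable_ae (u := atTop)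
    (f := fun N g => ∑ n ∈ Finset.range N,
      (((√2 / freq n : ℝ) : ℂ) * g n) • hermiteElement (-σ) n) (fun N => ?_) ?_
  · refine Continuous.aemeasurable ?_
    rw [(isInducing_toLp (-σ)).continuous_iff]
    have : (HSpace.toLp (-σ)) ∘ (fun g : ℕ → ℂ => ∑ n ∈ Finset.range N,
        (((√2 / freq n : ℝ) : ℂ) * g n) • hermiteElement (-σ) n) =
        fun g => ∑ n ∈ Finset.range N,
          (((√2 / freq n : ℝ) : ℂ) * g n) • HSpace.toLp (-σ) (hermiteElement (-σ) n) := by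
      funext g
      simp only [Function.comp, map_sum, map_smul]
    rw [this]
    fun_prop
  · filter_upwards [ae_coeff_randomElement hσ] with g hg
    rw [(isInducing_toLp (-σ)).tendsto_nhds_iff]
    have h := (lp.hasSum_single (p := 2) (by simp)
      (HSpace.toLp (-σ) (randomElement (-σ) g))).tendsto_sum_nat
    refine h.congr fun N => ?_
    simp only [Function.comp, map_sum, toLp_smul_hermiteElement]
    refine Finset.sum_congr rfl fun n _ => ?_
    rw [← hg]
    rfl

theorem freeMeasure_isProbabilityMeasure {σ : ℝ} (hσ : 0 < σ) :
    IsProbabilityMeasure (freeMeasure σ) :=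
  Measure.isProbabilityMeasure_map (aemeasurable_randomElement hσ)

/-- Integrals against `μ` of functions of the coefficients are Gaussian integrals. -/
theorem lintegral_freeMeasure {σ : ℝ} (hσ : 0 < σ) {F : HSpace (-σ) → ℝ≥0∞} (hF : Measurable F)
    {f : (ℕ → ℂ) → ℝ≥0∞}
    (h : ∀ (u : HSpace (-σ)) (g : ℕ → ℂ),
      (∀ n, coeff u.toDistr n = ((√2 / freq n : ℝ) : ℂ) * g n) → F u = f g) :
    ∫⁻ u, F u ∂freeMeasure σ = ∫⁻ g, f g ∂gaussianSeq := by
  rw [freeMeasure, lintegral_map' hF.aemeasurable (aemeasurable_randomElement hσ)]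
  refine lintegral_congr_ae ?_
  filter_upwards [ae_coeff_randomElement hσ] with g hg
  exact h _ _ hg

/-! ### Convergence in measure -/

theorem eLpNorm_natCast_eq {α : Type*} [MeasurableSpace α] {μ : Measure α} {k : ℕ} (hk : k ≠ 0)
    (f : α → ℝ) :
    eLpNorm f k μ = (∫⁻ x, ENNReal.ofReal (|f x| ^ k) ∂μ) ^ (1 / (k : ℝ)) := by
  rw [eLpNorm_eq_lintegral_rpow_enorm_toReal (by exact_mod_cast hk) (by simp),
    ENNReal.toReal_natCast]
  congr 2
  funext x
  rw [ENNReal.rpow_natCast, ← Real.norm_eq_abs, ← ofReal_norm, ENNReal.ofReal_pow (norm_nonneg _)]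

/-- A sequence of measurable functions that is Cauchy in the mean of order `k` converges in measure;
the functions themselves need not be integrable. -/
theorem exists_tendstoInMeasure_of_lintegral_le {α : Type*} [MeasurableSpace α] {μ : Measure α}
    {k : ℕ} (hk : 1 ≤ k) {f : ℕ → α → ℝ} (hf : ∀ n, Measurable (f n)) {B : ℕ → ℝ≥0∞}
    (hB : Tendsto B atTop (𝓝 0))
    (h : ∀ K n m, K ≤ n → K ≤ m → ∫⁻ x, ENNReal.ofReal (|f n x - f m x| ^ k) ∂μ ≤ B K) :
    ∃ F : α → ℝ, Measurable F ∧ TendstoInMeasure μ f atTop F := by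
  have hk0 : k ≠ 0 := by omega
  have hkr : 0 < 1 / (k : ℝ) := by positivity
  have : Fact (1 ≤ (k : ℝ≥0∞)) := ⟨by exact_mod_cast hk⟩
  have hB' : Tendsto (fun K => B K ^ (1 / (k : ℝ))) atTop (𝓝 0) := by
    have := hB.ennrpow_const (1 / (k : ℝ))
    rwa [ENNReal.zero_rpow_of_pos hkr] at this
  have hle : ∀ K n m, K ≤ n → K ≤ m → eLpNorm (f n - f m) k μ ≤ B K ^ (1 / (k : ℝ)) := by
    intro K n m hn hm
    rw [eLpNorm_natCast_eq hk0]
    exact ENNReal.rpow_le_rpow (h K n m hn hm) hkr.le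
  obtain ⟨K, hK⟩ := (hB'.eventually (gt_mem_nhds (zero_lt_one' ℝ≥0∞))).exists
  -- Subtracting a fixed member of the sequence gives functions in `L^k`.
  have hmem : ∀ n, MemLp (f (n + K) - f K) k μ := fun n =>
    ⟨((hf _).sub (hf _)).aestronglyMeasurable,
      ((hle K (n + K) K (by omega) le_rfl).trans_lt (hK.trans ENNReal.one_lt_top))⟩
  have hcau : CauchySeq fun n => (hmem n).toLp := by
    rw [EMetric.cauchySeq_iff]
    intro ε hε
    obtain ⟨N, hN⟩ := (hB'.eventually (gt_mem_nhds hε)).exists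
    refine ⟨N, fun n hn m hm => ?_⟩
    rw [Lp.edist_toLp_toLp, sub_sub_sub_cancel_right]
    exact (hle N _ _ (by omega) (by omega)).trans_lt hN
  obtain ⟨G, hG⟩ := cauchySeq_tendsto_of_complete hcau
  have h1 := tendstoInMeasure_of_tendsto_Lp hG
  have h2 : TendstoInMeasure μ (fun n => f (n + K) - f K) atTop G :=
    h1.congr_left fun n => (hmem n).coeFn_toLp
  refine ⟨fun x => G x + f K x, (Lp.stronglyMeasurable G).measurable.add (hf K), fun ε hε => ?_⟩
  rw [← tendsto_add_atTop_iff_nat K]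
  refine (h2 ε hε).congr fun n => ?_
  congr 1
  ext x
  rw [mem_ofPred_eq, mem_ofPred_eq, edist_dist, edist_dist, Real.dist_eq, Real.dist_eq]
  have : (f (n + K) - f K) x - G x = f (n + K) x - (G x + f K x) := by rw [Pi.sub_apply]; ring
  rw [← this]

theorem tendstoInMeasure_continuous_comp₂ {α : Type*} [MeasurableSpace α] {μ : Measure α}
    [IsFiniteMeasure μ] {f g : ℕ → α → ℝ} {F G : α → ℝ} (hf : ∀ n, Measurable (f n))
    (hg : ∀ n, Measurable (g n)) (hF : TendstoInMeasure μ f atTop F)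
    (hG : TendstoInMeasure μ g atTop G) {p : ℝ × ℝ → ℝ} (hp : Continuous p) :
    TendstoInMeasure μ (fun n x => p (f n x, g n x)) atTop fun x => p (F x, G x) := by
  refine (exists_seq_tendstoInMeasure_atTop_iff (f := fun n x => p (f n x, g n x)) fun n =>
    (hp.measurable.comp ((hf n).prodMk (hg n))).aestronglyMeasurable).2 ?_
  intro ns hns
  obtain ⟨ms, hms, h1⟩ := (hF.comp hns.tendsto_atTop).exists_seq_tendsto_ae
  obtain ⟨ls, hls, h2⟩ := (hG.comp (hns.comp hms).tendsto_atTop).exists_seq_tendsto_ae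
  refine ⟨ms ∘ ls, hms.comp hls, ?_⟩
  filter_upwards [h1, h2] with x hx1 hx2
  exact (hp.tendsto _).comp ((hx1.comp hls.tendsto_atTop).prodMk_nhds hx2)

/-! ### The renormalised mass -/

theorem integral_norm_sharpProj_sq {s : ℝ} (N : ℕ) (u : HSpace s) :
    ∫ x, ‖sharpProj N u x‖ ^ 2 = ∑ n ∈ Finset.range (N + 1), ‖coeff u.toDistr n‖ ^ 2 := by
  have h : ∀ x, ‖sharpProj N u x‖ ^ 2 =
      (∑ n ∈ Finset.range (N + 1), (coeff u.toDistr n).re * hermiteFun n x) *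
        (∑ n ∈ Finset.range (N + 1), (coeff u.toDistr n).re * hermiteFun n x) +
      (∑ n ∈ Finset.range (N + 1), (coeff u.toDistr n).im * hermiteFun n x) *
        (∑ n ∈ Finset.range (N + 1), (coeff u.toDistr n).im * hermiteFun n x) := fun x => by
    rw [← Complex.normSq_eq_norm_sq, Complex.normSq_apply, sharpProj, Complex.re_sum,
      Complex.im_sum]
    simp
  have hint : ∀ b : ℕ → ℝ, Integrable fun x =>
      (∑ n ∈ Finset.range (N + 1), b n * hermiteFun n x) *
        (∑ n ∈ Finset.range (N + 1), b n * hermiteFun n x) := fun b => by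
    have := schwartzMap_integrable_mul
      (∑ n ∈ Finset.range (N + 1), b n • hermiteSchwartzReal n)
      (∑ n ∈ Finset.range (N + 1), b n • hermiteSchwartzReal n)
    simp only [_root_.sum_apply] at this
    exact this
  simp_rw [h]
  rw [integral_add (hint _) (hint _), integral_sum_hermiteFun_mul_sum,
    integral_sum_hermiteFun_mul_sum, ← Finset.sum_add_distrib]
  refine Finset.sum_congr rfl fun n _ => ?_
  rw [← Complex.normSq_eq_norm_sq, Complex.normSq_apply]

/-- The contribution of the modes in `s` to the renormalised mass, in terms of the Gaussian
coordinates `g_n`. -/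
noncomputable def blockMass (s : Finset ℕ) (g : ℕ → ℂ) : ℝ :=
  ∑ n ∈ s, 2 / freq n ^ 2 * (‖g n‖ ^ 2 - 1)

theorem measurable_blockMass (s : Finset ℕ) : Measurable (blockMass s) := by
  unfold blockMass; fun_prop

/-- The renormalised mass `‖Π_N u‖² - α_N`. -/
noncomputable def renormMass {s : ℝ} (N : ℕ) (u : HSpace s) : ℝ :=
  (∫ x, ‖sharpProj N u x‖ ^ 2) - renormConst N

theorem measurable_renormMass {s : ℝ} (N : ℕ) : Measurable (renormMass (s := s) N) := by
  unfold renormMass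
  simp_rw [integral_norm_sharpProj_sq]
  have : ∀ n, Measurable fun u : HSpace s => coeff u.toDistr n :=
    fun n => (continuous_coeff n).measurable
  fun_prop

theorem renormMass_eq_blockMass {s : ℝ} {u : HSpace s} {g : ℕ → ℂ}
    (h : ∀ n, coeff u.toDistr n = ((√2 / freq n : ℝ) : ℂ) * g n) (N : ℕ) :
    renormMass N u = blockMass (Finset.range (N + 1)) g := by
  rw [renormMass, integral_norm_sharpProj_sq, renormConst, blockMass, ← Finset.sum_sub_distrib]
  refine Finset.sum_congr rfl fun n _ => ?_
  rw [h, norm_mul, Complex.norm_real, Real.norm_eq_abs, mul_pow, sq_abs, div_pow,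
    Real.sq_sqrt zero_le_two]
  ring

theorem integral_sq_norm_sq_sub_one :
    ∫ z : ℂ, (‖z‖ ^ 2 - 1) ^ 2 ∂stdComplexGaussian = 1 := by
  have h2 := integrable_norm_pow_stdComplexGaussian 1
  have i2 := integral_norm_pow_stdComplexGaussian 1
  have h4 := integrable_norm_pow_stdComplexGaussian 2
  have i4 := integral_norm_pow_stdComplexGaussian 2
  simp only [mul_one, Nat.factorial_one, Nat.factorial_two, Nat.cast_one,
    Nat.reduceMul] at h2 i2 h4 i4
  have : ∀ z : ℂ, (‖z‖ ^ 2 - 1) ^ 2 = ‖z‖ ^ 4 - 2 * ‖z‖ ^ 2 + 1 := fun z => by ring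
  simp_rw [this]
  have h42 : Integrable (fun z : ℂ => ‖z‖ ^ 4 - 2 * ‖z‖ ^ 2) stdComplexGaussian :=
    h4.sub (h2.const_mul 2)
  rw [integral_add h42 (integrable_const _), integral_sub h4 (h2.const_mul 2),
    integral_const_mul, i4, i2]
  norm_num

/-- The block masses are sums of independent centred variables, so their variances add up. -/
theorem lintegral_blockMass_sq (s : Finset ℕ) :
    ∫⁻ g, ENNReal.ofReal (blockMass s g ^ 2) ∂gaussianSeq =
      ENNReal.ofReal (∑ n ∈ s, (2 / freq n ^ 2) ^ 2) := by
  let X : ℕ → (ℕ → ℂ) → ℝ := fun n g => 2 / freq n ^ 2 * (‖g n‖ ^ 2 - 1)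
  have hmp : ∀ n, MeasurePreserving (fun g : ℕ → ℂ => g n) gaussianSeq stdComplexGaussian :=
    fun n => ⟨measurable_pi_apply n, map_eval_gaussianSeq n⟩
  have h2 := integrable_norm_pow_stdComplexGaussian 1
  have i2 := integral_norm_pow_stdComplexGaussian 1
  simp only [mul_one, Nat.factorial_one, Nat.cast_one] at h2 i2
  have hL : MemLp (fun z : ℂ => ‖z‖ ^ 2 - 1) 2 stdComplexGaussian := by
    rw [memLp_two_iff_integrable_sq (by fun_prop)]
    -- A function that is not integrable has integral `0` by convention.
    by_contra hc
    have := integral_sq_norm_sq_sub_one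
    rw [integral_undef hc] at this
    exact zero_ne_one this
  have hX : ∀ n, MemLp (X n) 2 gaussianSeq := fun n =>
    (hL.comp_measurePreserving (hmp n)).const_mul _
  have hmean : ∀ n, ∫ g, X n g ∂gaussianSeq = 0 := fun n => by
    have h := integral_map (μ := gaussianSeq) (measurable_pi_apply n).aemeasurable
      (f := fun z : ℂ => ‖z‖ ^ 2 - 1) (by fun_prop)
    rw [map_eval_gaussianSeq, integral_sub h2 (integrable_const _), i2] at h
    simp only [X]
    rw [integral_const_mul, ← h]
    simp
  have hvar : ∀ n,
      ProbabilityTheory.variance (X n) gaussianSeq = (2 / freq n ^ 2) ^ 2 := fun n => by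
    rw [ProbabilityTheory.variance_of_integral_eq_zero (hX n).aemeasurable (hmean n)]
    have h := integral_map (μ := gaussianSeq) (measurable_pi_apply n).aemeasurable
      (f := fun z : ℂ => (‖z‖ ^ 2 - 1) ^ 2) (by fun_prop)
    rw [map_eval_gaussianSeq, integral_sq_norm_sq_sub_one] at h
    simp only [X, mul_pow]
    rw [integral_const_mul, ← h, mul_one]
  have hS : ∑ n ∈ s, X n = blockMass s := by
    funext g; rw [Finset.sum_apply]; rfl
  have hind : ∀ i j, i ≠ j → ProbabilityTheory.IndepFun (X i) (X j) gaussianSeq := fun i j hij =>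
    (iIndepFun_eval_gaussianSeq.indepFun hij).comp
      (by fun_prop : Measurable fun z : ℂ => 2 / freq i ^ 2 * (‖z‖ ^ 2 - 1))
      (by fun_prop : Measurable fun z : ℂ => 2 / freq j ^ 2 * (‖z‖ ^ 2 - 1))
  have hV := ProbabilityTheory.IndepFun.variance_sum (μ := gaussianSeq) (s := s)
    (fun i _ => hX i) (fun i _ j _ hij => hind i j hij)
  have hSL : MemLp (blockMass s) 2 gaussianSeq := hS ▸ memLp_finsetSum' s fun i _ => hX i
  have hS0 : ∫ g, blockMass s g ∂gaussianSeq = 0 := by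
    have : ∀ g, blockMass s g = ∑ n ∈ s, X n g := fun g => rfl
    simp_rw [this]
    rw [integral_finsetSum _ fun n _ => (hX n).integrable (by norm_num)]
    simp [hmean]
  rw [hS, ProbabilityTheory.variance_of_integral_eq_zero hSL.aemeasurable hS0] at hV
  simp_rw [hvar] at hV
  rw [← hV, ofReal_integral_eq_lintegral_ofReal hSL.integrable_sq
    (ae_of_all _ fun g => sq_nonneg _)]

theorem summable_variance : Summable fun n => (2 / freq n ^ 2) ^ 2 := by
  refine ((summable_freq_rpow (t := 4) (by norm_num)).mul_left 4).congr fun n => ?_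
  have hf := freq_pos n
  rw [Real.rpow_neg hf.le]
  norm_cast
  field_simp; norm_num

theorem blockMass_sub {a b : ℕ} (hab : a ≤ b) (g : ℕ → ℂ) :
    blockMass (Finset.range b) g - blockMass (Finset.range a) g = blockMass (Finset.Ico a b) g := by
  rw [blockMass, blockMass, blockMass, Finset.sum_Ico_eq_sub _ hab]

theorem sum_Ico_le_tsum_tail {f : ℕ → ℝ} (hf0 : ∀ n, 0 ≤ f n) (hf : Summable f) {k a b : ℕ}
    (hka : k ≤ a) : ∑ n ∈ Finset.Ico a b, f n ≤ ∑' n, f (n + k) := by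
  have h1 : Summable fun n => f (n + k) := (summable_nat_add_iff k).2 hf
  have h2 : ∑ n ∈ Finset.Ico a b, f n = ∑ n ∈ Finset.Ico (a - k) (b - k), f (n + k) := by
    rw [Finset.sum_Ico_add' f]
    rcases le_or_gt k b with hb | hb
    · rw [Nat.sub_add_cancel hka, Nat.sub_add_cancel hb]
    · rw [Finset.Ico_eq_empty (by omega), Finset.Ico_eq_empty (by omega)]
  rw [h2]
  exact h1.sum_le_tsum _ fun n _ => hf0 _

theorem lintegral_renormMass_sub_sq_le {σ : ℝ} (hσ : 0 < σ) (K n m : ℕ) (hn : K ≤ n) (hm : K ≤ m) :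
    ∫⁻ u, ENNReal.ofReal (|renormMass n u - renormMass m u| ^ 2) ∂freeMeasure σ ≤
      ENNReal.ofReal (∑' i, (2 / freq (i + K) ^ 2) ^ 2) := by
  wlog hmn : m ≤ n generalizing n m
  · simp_rw [abs_sub_comm (renormMass n _)]
    exact this m n hm hn (by omega)
  rw [lintegral_freeMeasure hσ (f := fun g => ENNReal.ofReal
    (blockMass (Finset.Ico (m + 1) (n + 1)) g ^ 2)) ?_ ?_, lintegral_blockMass_sq]
  · exact ENNReal.ofReal_le_ofReal
      (sum_Ico_le_tsum_tail (fun n => sq_nonneg _) summable_variance (by omega))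
  · have := measurable_renormMass (s := -σ)
    fun_prop
  · intro u g h
    rw [renormMass_eq_blockMass h, renormMass_eq_blockMass h, blockMass_sub (by omega), sq_abs]

/-- The renormalised mass converges in measure. -/
theorem exists_limit_renormMass {σ : ℝ} (hσ : 0 < σ) :
    ∃ X : HSpace (-σ) → ℝ, Measurable X ∧
      TendstoInMeasure (freeMeasure σ) (fun N => renormMass N) atTop X := by
  refine exists_tendstoInMeasure_of_lintegral_le (k := 2) (by norm_num) measurable_renormMass
    (B := fun K => ENNReal.ofReal (∑' i, (2 / freq (i + K) ^ 2) ^ 2)) ?_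
    (lintegral_renormMass_sub_sq_le hσ)
  have := ENNReal.tendsto_ofReal (tendsto_sum_nat_add fun i => (2 / freq i ^ 2) ^ 2)
  simpa using this

/-! ### The interaction energy -/

section Interaction

variable {χ : ℝ → ℝ}

theorem cutoff_eq_zero (hχ_supp : tsupport χ ⊆ Ioo (-1) 1) {N n : ℕ} (h : N ≤ n) :
    χ ((2 * n + 1) / (2 * N + 1)) = 0 := by
  refine image_eq_zero_of_notMem_tsupport fun hmem => ?_
  have h1 := (hχ_supp hmem).2
  rw [div_lt_one (by positivity)] at h1
  have : (N : ℝ) ≤ n := by exact_mod_cast h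
  linarith

theorem cutoff_eq_one (hχ_one : ∀ x ∈ Icc (-(1 / 2) : ℝ) (1 / 2), χ x = 1) {N n : ℕ}
    (h : 2 * n + 1 ≤ N) : χ ((2 * n + 1) / (2 * N + 1)) = 1 := by
  refine hχ_one _ ⟨?_, ?_⟩
  · have : (0 : ℝ) ≤ (2 * n + 1) / (2 * N + 1) := by positivity
    linarith
  · rw [div_le_iff₀ (by positivity)]
    have : (2 * n + 1 : ℝ) ≤ N := by exact_mod_cast h
    linarith

theorem exists_abs_cutoff_le (hχ : ContDiff ℝ ∞ χ) (hχ_supp : tsupport χ ⊆ Ioo (-1) 1) :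
    ∃ C : ℝ, ∀ x, |χ x| ≤ C := by
  obtain ⟨C, hC⟩ := (isCompact_Icc (a := (-1 : ℝ)) (b := 1)).exists_bound_of_continuousOn
    hχ.continuous.continuousOn
  refine ⟨C, fun x => ?_⟩
  by_cases hx : x ∈ Icc (-1 : ℝ) 1
  · exact hC x hx
  · have h0 : χ x = 0 := image_eq_zero_of_notMem_tsupport fun hmem =>
      hx (Ioo_subset_Icc_self (hχ_supp hmem))
    rw [h0, abs_zero]
    exact (norm_nonneg _).trans (hC 0 (by norm_num))

theorem smoothProj_eq_sum (hχ_supp : tsupport χ ⊆ Ioo (-1) 1) {s : ℝ} {N M : ℕ} (hNM : N ≤ M)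
    (u : HSpace s) (x : ℝ) :
    smoothProj χ N u x = ∑ n ∈ Finset.range M,
      (χ ((2 * n + 1) / (2 * N + 1)) : ℂ) * coeff u.toDistr n * (hermiteFun n x : ℂ) := by
  refine tsum_eq_sum fun n hn => ?_
  rw [cutoff_eq_zero hχ_supp (hNM.trans (by simpa using hn))]
  simp

/-- `S_N u` as a Schwartz function. -/
noncomputable def smoothSchwartz (χ : ℝ → ℝ) {s : ℝ} (N : ℕ) (u : HSpace s) : 𝓢(ℝ, ℂ) :=
  ∑ n ∈ Finset.range N,
    ((χ ((2 * n + 1) / (2 * N + 1)) : ℂ) * coeff u.toDistr n) • hermiteSchwartz n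

theorem smoothSchwartz_apply (hχ_supp : tsupport χ ⊆ Ioo (-1) 1) {s : ℝ} (N : ℕ) (u : HSpace s)
    (x : ℝ) : smoothSchwartz χ N u x = smoothProj χ N u x := by
  rw [smoothProj_eq_sum hχ_supp le_rfl, smoothSchwartz, _root_.sum_apply]
  rfl

/-- The norm of `S_N u` in `L⁴`. -/
noncomputable def smoothNorm (χ : ℝ → ℝ) {s : ℝ} (N : ℕ) (u : HSpace s) : ℝ :=
  ‖(smoothSchwartz χ N u).toLp 4 (volume : Measure ℝ)‖

theorem norm_toLp_four_pow (f : 𝓢(ℝ, ℂ)) :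
    ‖f.toLp 4 (volume : Measure ℝ)‖ ^ 4 = ∫ x, ‖f x‖ ^ 4 := by
  rw [SchwartzMap.norm_toLp' (by norm_num) (by norm_num)]
  simp only [ENNReal.toReal_ofNat]
  rw [← Real.rpow_natCast, ← Real.rpow_mul (integral_nonneg fun x => by positivity)]
  norm_num

theorem smoothNorm_pow_four (hχ_supp : tsupport χ ⊆ Ioo (-1) 1) {s : ℝ} (N : ℕ) (u : HSpace s) :
    smoothNorm χ N u ^ 4 = ∫ x, ‖smoothProj χ N u x‖ ^ 4 := by
  rw [smoothNorm, norm_toLp_four_pow]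
  simp_rw [smoothSchwartz_apply hχ_supp]

theorem continuous_smoothNorm {s : ℝ} (N : ℕ) : Continuous (smoothNorm χ (s := s) N) := by
  have : ∀ u : HSpace s, (smoothSchwartz χ N u).toLp 4 (volume : Measure ℝ) =
      ∑ n ∈ Finset.range N, ((χ ((2 * n + 1) / (2 * N + 1)) : ℂ) * coeff u.toDistr n) •
        (hermiteSchwartz n).toLp 4 (volume : Measure ℝ) := fun u => by
    have : Fact ((1 : ℝ≥0∞) ≤ 4) := ⟨by norm_num⟩
    rw [← SchwartzMap.toLpCLM_apply (𝕜 := ℂ), smoothSchwartz, map_sum]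
    simp only [map_smul, SchwartzMap.toLpCLM_apply]
  unfold smoothNorm
  simp_rw [this]
  have hc : ∀ n, Continuous fun u : HSpace s => coeff u.toDistr n := continuous_coeff
  have : Fact ((1 : ℝ≥0∞) ≤ 4) := ⟨by norm_num⟩
  fun_prop

/-- The reverse triangle inequality in `L⁴`. -/
theorem ofReal_abs_smoothNorm_sub_le (hχ_supp : tsupport χ ⊆ Ioo (-1) 1) {s : ℝ} (n m : ℕ)
    (u : HSpace s) :
    ENNReal.ofReal (|smoothNorm χ n u - smoothNorm χ m u| ^ 4) ≤
      ∫⁻ x, ENNReal.ofReal (‖smoothProj χ n u x - smoothProj χ m u x‖ ^ 4) := by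
  have : Fact ((1 : ℝ≥0∞) ≤ 4) := ⟨by norm_num⟩
  have h1 : |smoothNorm χ n u - smoothNorm χ m u| ≤
      ‖(smoothSchwartz χ n u - smoothSchwartz χ m u).toLp 4 (volume : Measure ℝ)‖ := by
    rw [← SchwartzMap.toLpCLM_apply (𝕜 := ℂ), map_sub]
    exact abs_norm_sub_norm_le _ _
  have hint : Integrable fun x => ‖(smoothSchwartz χ n u - smoothSchwartz χ m u) x‖ ^ 4 := by
    have := ((smoothSchwartz χ n u - smoothSchwartz χ m u).memLp 4 volume).integrable_norm_rpow
      (by norm_num) (by norm_num)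
    refine this.congr (Eventually.of_forall fun x => ?_)
    simp only [ENNReal.toReal_ofNat]
    norm_cast
  calc _ ≤ ENNReal.ofReal
        (‖(smoothSchwartz χ n u - smoothSchwartz χ m u).toLp 4 (volume : Measure ℝ)‖ ^ 4) :=
        ENNReal.ofReal_le_ofReal (pow_le_pow_left₀ (abs_nonneg _) h1 4)
    _ = _ := by
      rw [norm_toLp_four_pow, ofReal_integral_eq_lintegral_ofReal hint
        (ae_of_all _ fun x => by positivity)]
      simp_rw [_root_.sub_apply, smoothSchwartz_apply hχ_supp]

/-- The variance of `S_n u(x) - S_m u(x)` is controlled by a tail of the Green function. -/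
theorem sum_sq_cutoff_sub_le (hχ_one : ∀ x ∈ Icc (-(1 / 2) : ℝ) (1 / 2), χ x = 1) {C : ℝ}
    (hC : ∀ x, |χ x| ≤ C) {K n m M : ℕ} (hn : K ≤ n) (hm : K ≤ m) (x : ℝ) :
    ∑ i ∈ Finset.range M, ((χ ((2 * i + 1) / (2 * n + 1)) - χ ((2 * i + 1) / (2 * m + 1))) *
      (√2 / freq i) * hermiteFun i x) ^ 2 ≤
      8 * C ^ 2 * ∑' i, hermiteFun (i + K / 2) x ^ 2 / freq (i + K / 2) ^ 2 := by
  have hterm : ∀ i : ℕ, ((χ ((2 * i + 1) / (2 * n + 1)) - χ ((2 * i + 1) / (2 * m + 1))) *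
      (√2 / freq i) * hermiteFun i x) ^ 2 ≤ 8 * C ^ 2 * (hermiteFun i x ^ 2 / freq i ^ 2) := by
    intro i
    have h1 : (χ ((2 * i + 1) / (2 * n + 1)) - χ ((2 * i + 1) / (2 * m + 1))) ^ 2 ≤
        (2 * C) ^ 2 := by
      rw [← sq_abs]
      refine pow_le_pow_left₀ (abs_nonneg _) ((abs_sub _ _).trans ?_) 2
      linarith [hC ((2 * i + 1) / (2 * n + 1)), hC ((2 * i + 1) / (2 * m + 1))]
    rw [mul_pow, mul_pow, div_pow, Real.sq_sqrt zero_le_two]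
    have h2 : 0 ≤ hermiteFun i x ^ 2 / freq i ^ 2 := by positivity
    calc _ = 2 * (χ ((2 * i + 1) / (2 * n + 1)) - χ ((2 * i + 1) / (2 * m + 1))) ^ 2 *
          (hermiteFun i x ^ 2 / freq i ^ 2) := by ring
      _ ≤ 2 * (2 * C) ^ 2 * (hermiteFun i x ^ 2 / freq i ^ 2) := by gcongr
      _ = _ := by ring
  calc _ = ∑ i ∈ Finset.Ico (K / 2) M, ((χ ((2 * i + 1) / (2 * n + 1)) -
        χ ((2 * i + 1) / (2 * m + 1))) * (√2 / freq i) * hermiteFun i x) ^ 2 := by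
        symm
        refine Finset.sum_subset (fun i hi => ?_) fun i hi hi' => ?_
        · simp only [Finset.mem_Ico, Finset.mem_range] at hi ⊢
          exact hi.2
        · -- Below `K / 2` both cut-offs are equal to `1`.
          have hiK : i < K / 2 := by
            simp only [Finset.mem_Ico, Finset.mem_range] at hi hi'
            omega
          rw [cutoff_eq_one hχ_one (by omega), cutoff_eq_one hχ_one (by omega)]
          simp
    _ ≤ ∑ i ∈ Finset.Ico (K / 2) M, 8 * C ^ 2 * (hermiteFun i x ^ 2 / freq i ^ 2) :=
        Finset.sum_le_sum fun i _ => hterm i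
    _ ≤ _ := by
        rw [← Finset.mul_sum]
        gcongr
        exact sum_Ico_le_tsum_tail (f := fun i => hermiteFun i x ^ 2 / freq i ^ 2)
          (fun i => by positivity) (summable_hermiteFun_sq_div x) le_rfl

theorem lintegral_smoothNorm_sub_pow_le (hχ_supp : tsupport χ ⊆ Ioo (-1) 1)
    (hχ_one : ∀ x ∈ Icc (-(1 / 2) : ℝ) (1 / 2), χ x = 1) {C : ℝ} (hC : ∀ x, |χ x| ≤ C)
    {σ : ℝ} (hσ : 0 < σ) (K n m : ℕ) (hn : K ≤ n) (hm : K ≤ m) :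
    ∫⁻ u, ENNReal.ofReal (|smoothNorm χ n u - smoothNorm χ m u| ^ 4) ∂freeMeasure σ ≤
      ENNReal.ofReal (3 * (8 * C ^ 2) ^ 2) * ∫⁻ x, ENNReal.ofReal
        ((∑' i, hermiteFun (i + K / 2) x ^ 2 / freq (i + K / 2) ^ 2) ^ 2) := by
  have := freeMeasure_isProbabilityMeasure hσ
  set M := max n m with hM
  let b : ℕ → ℝ := fun i => χ ((2 * i + 1) / (2 * n + 1)) - χ ((2 * i + 1) / (2 * m + 1))
  have hdiff : ∀ (u : HSpace (-σ)) x, smoothProj χ n u x - smoothProj χ m u x =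
      ∑ i ∈ Finset.range M, (b i : ℂ) * coeff u.toDistr i * (hermiteFun i x : ℂ) := by
    intro u x
    rw [smoothProj_eq_sum hχ_supp (le_max_left n m), smoothProj_eq_sum hχ_supp (le_max_right n m),
      ← Finset.sum_sub_distrib]
    refine Finset.sum_congr rfl fun i _ => ?_
    simp only [b]; push_cast; ring
  have hcm : ∀ i, Measurable fun u : HSpace (-σ) => coeff u.toDistr i :=
    fun i => (continuous_coeff i).measurable
  have hhm : ∀ i, Measurable (hermiteFun i) := fun i => (continuous_hermiteFun i).measurable
  have hmeas : Measurable (Function.uncurry fun (u : HSpace (-σ)) (x : ℝ) =>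
      ENNReal.ofReal (‖∑ i ∈ Finset.range M,
        (b i : ℂ) * coeff u.toDistr i * (hermiteFun i x : ℂ)‖ ^ 4)) := by
    have h1 : ∀ i, Measurable fun p : HSpace (-σ) × ℝ => coeff p.1.toDistr i :=
      fun i => (hcm i).comp measurable_fst
    have h2 : ∀ i, Measurable fun p : HSpace (-σ) × ℝ => hermiteFun i p.2 :=
      fun i => (hhm i).comp measurable_snd
    simp only [Function.uncurry_def]
    fun_prop
  calc _ ≤ ∫⁻ u, ∫⁻ x, ENNReal.ofReal (‖∑ i ∈ Finset.range M,
        (b i : ℂ) * coeff u.toDistr i * (hermiteFun i x : ℂ)‖ ^ 4) ∂volume ∂freeMeasure σ := by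
        refine lintegral_mono fun u => (ofReal_abs_smoothNorm_sub_le hχ_supp n m u).trans_eq ?_
        simp_rw [hdiff]
    _ = ∫⁻ x, ∫⁻ u, ENNReal.ofReal (‖∑ i ∈ Finset.range M,
        (b i : ℂ) * coeff u.toDistr i * (hermiteFun i x : ℂ)‖ ^ 4) ∂freeMeasure σ ∂volume :=
        lintegral_lintegral_swap hmeas.aemeasurable
    _ ≤ ∫⁻ x, ENNReal.ofReal (3 * (8 * C ^ 2) ^ 2) * ENNReal.ofReal
        ((∑' i, hermiteFun (i + K / 2) x ^ 2 / freq (i + K / 2) ^ 2) ^ 2) := by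
        refine lintegral_mono fun x => ?_
        rw [lintegral_freeMeasure hσ (f := fun g => ENNReal.ofReal (‖∑ i ∈ Finset.range M,
          ((b i * (√2 / freq i) * hermiteFun i x : ℝ) : ℂ) * g i‖ ^ 4)) (by fun_prop) ?_]
        · refine (lintegral_norm_gaussian_sum_pow_four_le _ _).trans ?_
          rw [← ENNReal.ofReal_mul (by positivity)]
          refine ENNReal.ofReal_le_ofReal ?_
          have h := sum_sq_cutoff_sub_le hχ_one hC hn hm x (M := M)
          have h2 := pow_le_pow_left₀ (Finset.sum_nonneg fun i _ => sq_nonneg _) h 2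
          rw [mul_pow] at h2
          simp only [b]
          linarith
        · intro u g h
          simp_rw [h]
          congr 3
          refine Finset.sum_congr rfl fun i _ => ?_
          push_cast; ring
    _ = _ := lintegral_const_mul' _ _ ENNReal.ofReal_ne_top

/-- The norms `‖S_N u‖_{L⁴}` converge in measure. -/
theorem exists_limit_smoothNorm (hχ : ContDiff ℝ ∞ χ) (hχ_supp : tsupport χ ⊆ Ioo (-1) 1)
    (hχ_one : ∀ x ∈ Icc (-(1 / 2) : ℝ) (1 / 2), χ x = 1) {σ : ℝ} (hσ : 0 < σ) :
    ∃ Z : HSpace (-σ) → ℝ, Measurable Z ∧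
      TendstoInMeasure (freeMeasure σ) (fun N => smoothNorm χ N) atTop Z := by
  obtain ⟨C, hC⟩ := exists_abs_cutoff_le hχ hχ_supp
  refine exists_tendstoInMeasure_of_lintegral_le (k := 4) (by norm_num)
    (fun N => (continuous_smoothNorm N).measurable) ?_
    (lintegral_smoothNorm_sub_pow_le hχ_supp hχ_one hC hσ)
  have h1 : Tendsto (fun K : ℕ => K / 2) atTop atTop := Nat.tendsto_div_const_atTop (by norm_num)
  have h2 := ENNReal.Tendsto.const_mul (a := ENNReal.ofReal (3 * (8 * C ^ 2) ^ 2))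
    (tendsto_integral_tail_sq.comp h1) (Or.inr ENNReal.ofReal_ne_top)
  rw [mul_zero] at h2
  exact h2

/-- The Gibbs density in terms of the limits of the renormalised mass and of the `L⁴` norm. -/
theorem tendstoInMeasure_approxDensity (hχ_supp : tsupport χ ⊆ Ioo (-1) 1) {σ : ℝ} (hσ : 0 < σ)
    {ζ : ℝ → ℝ} (hζ : ζ ∈ cutoffs) {X Z : HSpace (-σ) → ℝ}
    (hX : TendstoInMeasure (freeMeasure σ) (fun N => renormMass N) atTop X)
    (hZ : TendstoInMeasure (freeMeasure σ) (fun N => smoothNorm χ N) atTop Z) :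
    TendstoInMeasure (freeMeasure σ) (fun N => approxDensity χ ζ N) atTop
      fun u => ζ (X u) * Real.exp (1 / 4 * Z u ^ 4) := by
  have := freeMeasure_isProbabilityMeasure hσ
  have hζc : Continuous ζ := hζ.1.continuous
  have h := tendstoInMeasure_continuous_comp₂ (fun N => measurable_renormMass N)
    (fun N => (continuous_smoothNorm N).measurable) hX hZ
    (p := fun p => ζ p.1 * Real.exp (1 / 4 * p.2 ^ 4)) (by fun_prop)
  refine h.congr_left fun N => Eventually.of_forall fun u => ?_
  simp only [approxDensity, renormMass, smoothNorm_pow_four hχ_supp]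

theorem gibbsDensity_spec {σ : ℝ} {ζ : ℝ → ℝ}
    (h : ∃ G : HSpace (-σ) → ℝ, Measurable G ∧
      TendstoInMeasure (freeMeasure σ) (fun N => approxDensity χ ζ N) atTop G) :
    TendstoInMeasure (freeMeasure σ) (fun N => approxDensity χ ζ N) atTop
      (gibbsDensity σ χ ζ) := by
  rw [gibbsDensity, dif_pos h]
  exact h.choose_spec.2

end Interaction

/-! ### Prescribing the renormalised mass near a given distribution -/

theorem gaussianSeq_pos_of_isOpen {U : Set (ℕ → ℂ)} (hU : IsOpen U) {c : ℕ → ℂ} (hc : c ∈ U) :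
    0 < gaussianSeq U := by
  obtain ⟨I, u, hu, hsub⟩ := isOpen_pi_iff.1 hU c hc
  refine lt_of_lt_of_le ?_ (measure_mono hsub)
  rw [gaussianSeq]
  have h := Measure.infinitePi_pi (μ := fun _ : ℕ => stdComplexGaussian) (s := I) (t := u)
    fun i hi => (hu i hi).1.measurableSet
  rw [h]
  exact CanonicallyOrderedAdd.prod_pos.2 fun i hi =>
    stdComplexGaussian_pos_of_isOpen (hu i hi).1 ⟨c i, (hu i hi).2⟩

/-- Independence of the first `M` coordinates from the following ones. -/
theorem gaussianSeq_inter_block (f h : ℕ → ℂ → ℝ) (hf : ∀ n, Measurable (f n))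
    (hh : ∀ n, Measurable (h n)) {S T : Finset ℕ} (hST : Disjoint S T) {U V : Set (ℝ × ℝ)}
    (hU : MeasurableSet U) (hV : MeasurableSet V) :
    gaussianSeq ({g | (∑ n ∈ S, f n (g n), ∑ n ∈ S, h n (g n)) ∈ U} ∩
      {g | (∑ n ∈ T, f n (g n), ∑ n ∈ T, h n (g n)) ∈ V}) =
    gaussianSeq {g | (∑ n ∈ S, f n (g n), ∑ n ∈ S, h n (g n)) ∈ U} *
      gaussianSeq {g | (∑ n ∈ T, f n (g n), ∑ n ∈ T, h n (g n)) ∈ V} := by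
  have hm : ∀ S : Finset ℕ, Measurable fun v : S → ℂ =>
      (∑ n : S, f n (v n), ∑ n : S, h n (v n)) := fun S => by fun_prop
  have h1 := (iIndepFun_eval_gaussianSeq.indepFun_finset S T hST
    fun i => measurable_pi_apply i).comp (hm S) (hm T)
  have h2 := h1.measure_inter_preimage_eq_mul U V hU hV
  have e : ∀ (S : Finset ℕ) (U : Set (ℝ × ℝ)),
      {g : ℕ → ℂ | (∑ n ∈ S, f n (g n), ∑ n ∈ S, h n (g n)) ∈ U} =
      ((fun v : S → ℂ => (∑ n : S, f n (v n), ∑ n : S, h n (v n))) ∘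
        fun (g : ℕ → ℂ) (i : S) => g i) ⁻¹' U := by
    intro S U
    ext g
    simp only [mem_ofPred_eq, mem_preimage, Function.comp]
    rw [Finset.sum_coe_sort S fun n => f n (g n), Finset.sum_coe_sort S fun n => h n (g n)]
  rw [e S U, e T V]
  exact h2

/-- If two series of independent terms converge in measure, and the blocks following the first `M`
terms are small with probability at least one half, then both sums are simultaneously close to any
value that the first `M` terms can take. -/
theorem gaussianSeq_pos_of_blocks {f h : ℕ → ℂ → ℝ} (hf : ∀ n, Continuous (f n))
    (hh : ∀ n, Continuous (h n)) {X Y : (ℕ → ℂ) → ℝ}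
    (hX : TendstoInMeasure gaussianSeq (fun N g => ∑ n ∈ Finset.range N, f n (g n)) atTop X)
    (hY : TendstoInMeasure gaussianSeq (fun N g => ∑ n ∈ Finset.range N, h n (g n)) atTop Y)
    (M : ℕ) (c : ℕ → ℂ) {ε : ℝ} (hε : 0 < ε)
    (hB : ∀ N, 1 / 2 ≤ gaussianSeq {g | |∑ n ∈ Finset.Ico M N, f n (g n)| < ε ∧
      |∑ n ∈ Finset.Ico M N, h n (g n)| < ε}) :
    0 < gaussianSeq {g | |X g - ∑ n ∈ Finset.range M, f n (c n)| < 3 * ε ∧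
      |Y g - ∑ n ∈ Finset.range M, h n (c n)| < 3 * ε} := by
  set x := ∑ n ∈ Finset.range M, f n (c n) with hx
  set y := ∑ n ∈ Finset.range M, h n (c n) with hy
  let A : Set (ℕ → ℂ) := {g | (∑ n ∈ Finset.range M, f n (g n), ∑ n ∈ Finset.range M, h n (g n)) ∈
    Metric.ball x ε ×ˢ Metric.ball y ε}
  have hAo : IsOpen A := by
    refine (Metric.isOpen_ball.prod Metric.isOpen_ball).preimage ?_
    fun_prop
  have hA : 0 < gaussianSeq A := gaussianSeq_pos_of_isOpen hAo (c := c) (by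
    simp only [A, mem_ofPred_eq, mem_prod]
    exact ⟨Metric.mem_ball_self hε, Metric.mem_ball_self hε⟩)
  have hAfin : gaussianSeq A ≠ ⊤ := measure_ne_top _ _
  -- The two partial sums are within `ε` of their limits off an event with at most a quarter of the
  -- probability of `A`, while `A ∩ B` has at least half of it by independence.
  have hA8 : 0 < gaussianSeq A / 8 := ENNReal.div_pos hA.ne' (by norm_num)
  have hX' := (tendstoInMeasure_iff_dist.1 hX ε hε).eventually (gt_mem_nhds hA8)
  have hY' := (tendstoInMeasure_iff_dist.1 hY ε hε).eventually (gt_mem_nhds hA8)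
  obtain ⟨N, ⟨hN1, hN2⟩, hN⟩ := ((hX'.and hY').and (eventually_ge_atTop M)).exists
  let B : Set (ℕ → ℂ) := {g | (∑ n ∈ Finset.Ico M N, f n (g n), ∑ n ∈ Finset.Ico M N, h n (g n)) ∈
    Metric.ball (0 : ℝ) ε ×ˢ Metric.ball (0 : ℝ) ε}
  have hB' : 1 / 2 ≤ gaussianSeq B := by
    refine (hB N).trans_eq ?_
    congr 1
    ext g
    simp only [B, mem_ofPred_eq, mem_prod, Metric.mem_ball, Real.dist_eq, sub_zero]
  have hAB : gaussianSeq (A ∩ B) = gaussianSeq A * gaussianSeq B := by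
    refine gaussianSeq_inter_block f h (fun n => (hf n).measurable) (fun n => (hh n).measurable) ?_
      (Metric.isOpen_ball.prod Metric.isOpen_ball).measurableSet
      (Metric.isOpen_ball.prod Metric.isOpen_ball).measurableSet
    rw [Finset.range_eq_Ico]
    exact Finset.Ico_disjoint_Ico_consecutive 0 M N
  by_contra hcon
  have hzero := nonpos_iff_eq_zero.1 (not_lt.1 hcon)
  have hsub : A ∩ B ⊆ {g | |X g - x| < 3 * ε ∧ |Y g - y| < 3 * ε} ∪
      ({g | ε ≤ dist (∑ n ∈ Finset.range N, f n (g n)) (X g)} ∪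
        {g | ε ≤ dist (∑ n ∈ Finset.range N, h n (g n)) (Y g)}) := by
    intro g hg
    by_cases h1 : ε ≤ dist (∑ n ∈ Finset.range N, f n (g n)) (X g)
    · exact Or.inr (Or.inl h1)
    by_cases h2 : ε ≤ dist (∑ n ∈ Finset.range N, h n (g n)) (Y g)
    · exact Or.inr (Or.inr h2)
    refine Or.inl ?_
    simp only [A, B, mem_inter_iff, mem_ofPred_eq, mem_prod, Metric.mem_ball, Real.dist_eq,
      sub_zero] at hg
    obtain ⟨⟨a1, a2⟩, b1, b2⟩ := hg
    rw [← Finset.sum_range_add_sum_Ico _ hN, Real.dist_eq, not_le, abs_lt] at h1 h2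
    rw [abs_lt] at a1 a2 b1 b2
    constructor <;> rw [abs_lt] <;> constructor <;> linarith
  have hle : gaussianSeq A * (1 / 2) ≤ gaussianSeq A / 8 + gaussianSeq A / 8 := by
    calc gaussianSeq A * (1 / 2) ≤ gaussianSeq (A ∩ B) := by rw [hAB]; gcongr
      _ ≤ _ := measure_mono hsub
      _ ≤ _ := measure_union_le _ _
      _ ≤ 0 + _ := by rw [hzero]
      _ ≤ _ := by
        rw [zero_add]
        exact (measure_union_le _ _).trans (add_le_add hN1.le hN2.le)
  have hr : (gaussianSeq A).toReal * (1 / 2) ≤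
      (gaussianSeq A).toReal / 8 + (gaussianSeq A).toReal / 8 := by
    have := ENNReal.toReal_mono (by finiteness) hle
    rw [ENNReal.toReal_add (by finiteness) (by finiteness), ENNReal.toReal_mul,
      ENNReal.toReal_div] at this
    simpa using this
  have : 0 < (gaussianSeq A).toReal := ENNReal.toReal_pos hA.ne' hAfin
  linarith

theorem tendsto_sum_two_div_freq_sq :
    Tendsto (fun N => ∑ n ∈ Finset.range N, 2 / freq n ^ 2) atTop atTop := by
  refine tendsto_atTop_mono (fun N => ?_) Real.tendsto_sum_range_one_div_nat_succ_atTop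
  refine Finset.sum_le_sum fun n _ => ?_
  rw [freq_sq, div_le_div_iff₀ (by positivity) (by positivity)]
  linarith

theorem tendsto_freq_rpow_neg {t : ℝ} (ht : 0 < t) :
    Tendsto (fun n => freq n ^ (-t)) atTop (𝓝 0) := by
  refine (tendsto_rpow_neg_atTop ht).comp ?_
  refine Real.tendsto_sqrt_atTop.comp ?_
  refine tendsto_atTop_mono (fun n : ℕ => ?_) tendsto_natCast_atTop_atTop
  linarith [(Nat.cast_nonneg n : (0 : ℝ) ≤ n)]

/-- Near any element of `ℋ^{-σ}`, with Gaussian coordinates `b`, there are finite sequences of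
coordinates with any prescribed renormalised mass: removing many high modes lowers the mass as far
as desired since `∑ 2 / λ_n²` diverges, and a single mode of very high frequency, which has small
norm in `ℋ^{-σ}`, makes up the difference. -/
theorem exists_profile {σ : ℝ} (hσ : 0 < σ) {b : ℕ → ℂ}
    (hb : Summable fun n => normWeight σ n * ‖b n‖ ^ 2) {δ : ℝ} (hδ : 0 < δ) (x : ℝ) (M₀ : ℕ) :
    ∃ M, M₀ ≤ M ∧ ∃ c : ℕ → ℂ,
      ∑ n ∈ Finset.range M, normWeight σ n * ‖c n - b n‖ ^ 2 < δ ∧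
      ∑ n ∈ Finset.range M, 2 / freq n ^ 2 * (‖c n‖ ^ 2 - 1) = x := by
  have hW := normWeight_nonneg σ
  let q : ℕ → ℝ := fun n => 2 * (normWeight σ n * (1 + ‖b n‖ ^ 2))
  have hq0 : ∀ n, 0 ≤ q n := fun n => mul_nonneg zero_le_two (mul_nonneg (hW n) (by positivity))
  have hq : Summable q := by
    refine Summable.mul_left 2 (((summable_normWeight hσ).add hb).congr fun n => ?_)
    ring
  obtain ⟨M₁, hM₁, hM₀⟩ := (((tendsto_sum_nat_add q).eventually
    (gt_mem_nhds (half_pos hδ))).and (eventually_ge_atTop M₀)).exists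
  set D := x - ∑ n ∈ Finset.range M₁, 2 / freq n ^ 2 * (‖b n‖ ^ 2 - 1) with hD
  obtain ⟨K, hK, hMK⟩ := ((tendsto_sum_two_div_freq_sq.eventually
    (eventually_ge_atTop (∑ n ∈ Finset.range M₁, 2 / freq n ^ 2 - D))).and
    (eventually_ge_atTop M₁)).exists
  set D' := D + ∑ n ∈ Finset.Ico M₁ K, 2 / freq n ^ 2 with hD'
  have hD'0 : 0 ≤ D' := by
    rw [← Finset.sum_range_add_sum_Ico _ hMK] at hK
    linarith
  have hlim : Tendsto (fun n => 2 * (freq n ^ (-(2 * σ)) * D')) atTop (𝓝 0) := by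
    have := ((tendsto_freq_rpow_neg (t := 2 * σ) (by positivity)).mul_const D').const_mul 2
    simpa using this
  obtain ⟨n₀, hn₀, hKn₀⟩ := ((hlim.eventually (gt_mem_nhds (half_pos hδ))).and
    (eventually_ge_atTop K)).exists
  have hw : ∀ n, 0 < 2 / freq n ^ 2 := fun n => by have := freq_pos n; positivity
  let r : ℝ := √(1 + D' / (2 / freq n₀ ^ 2))
  have hr : r ^ 2 = 1 + D' / (2 / freq n₀ ^ 2) :=
    Real.sq_sqrt (add_nonneg zero_le_one (div_nonneg hD'0 (hw n₀).le))
  -- The zeros on `[M₁, K)` lower the mass below the target, the ones on `[K, n₀)` do not affect it,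
  -- and the mode `n₀` supplies the deficit `D'`.
  let c : ℕ → ℂ := fun n =>
    if n < M₁ then b n else if n < K then 0 else if n < n₀ then 1 else (r : ℂ)
  have c1 : ∀ n, n < M₁ → c n = b n := fun n h => if_pos h
  have c2 : ∀ n, M₁ ≤ n → n < K → c n = 0 := fun n h1 h2 => by
    simp only [c, if_neg (not_lt.2 h1), if_pos h2]
  have c3 : ∀ n, K ≤ n → n < n₀ → c n = 1 := fun n h1 h2 => by
    simp only [c, if_neg (not_lt.2 (hMK.trans h1)), if_neg (not_lt.2 h1), if_pos h2]
  have c4 : c n₀ = r := by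
    simp only [c, if_neg (not_lt.2 (hMK.trans hKn₀)), if_neg (not_lt.2 hKn₀), lt_irrefl, if_false]
  have hnr : ‖(r : ℂ)‖ ^ 2 = 1 + D' / (2 / freq n₀ ^ 2) := by
    rw [Complex.norm_real, Real.norm_eq_abs, sq_abs, hr]
  refine ⟨n₀ + 1, by omega, c, ?_, ?_⟩
  · have hterm : ∀ n ∈ Finset.range (n₀ + 1), normWeight σ n * ‖c n - b n‖ ^ 2 ≤
        (if M₁ ≤ n then q n else 0) + if n = n₀ then 2 * (freq n₀ ^ (-(2 * σ)) * D') else 0 := by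
      intro n hn
      have hbd : ‖c n - b n‖ ^ 2 ≤ 2 * ‖c n‖ ^ 2 + 2 * ‖b n‖ ^ 2 := by
        have := pow_le_pow_left₀ (norm_nonneg _) (norm_sub_le (c n) (b n)) 2
        nlinarith [sq_nonneg (‖c n‖ - ‖b n‖)]
      have hbd' := mul_le_mul_of_nonneg_left hbd (hW n)
      have hlt : n < n₀ + 1 := Finset.mem_range.1 hn
      by_cases h1 : M₁ ≤ n
      · rw [if_pos h1]
        by_cases h4 : n = n₀
        · rw [if_pos h4]
          subst h4
          have h5 : normWeight σ n * (D' / (2 / freq n ^ 2)) = freq n ^ (-(2 * σ)) * D' := by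
            rw [normWeight, show 2 * -σ = -(2 * σ) by ring]
            have := (freq_pos n).ne'
            field_simp
          rw [c4, hnr] at hbd'
          rw [c4]
          simp only [q]
          nlinarith
        · have h6 : ‖c n‖ ^ 2 ≤ 1 := by
            rcases lt_or_ge n K with h | h
            · rw [c2 n h1 h]; simp
            · rw [c3 n h (by omega)]; simp
          rw [if_neg h4]
          simp only [q]
          nlinarith [mul_le_mul_of_nonneg_left h6 (hW n)]
      · have h5 : n ≠ n₀ := by omega
        rw [c1 n (not_le.1 h1), if_neg h1, if_neg h5]
        simp
    calc _ ≤ ∑ n ∈ Finset.range (n₀ + 1), ((if M₁ ≤ n then q n else 0) +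
          if n = n₀ then 2 * (freq n₀ ^ (-(2 * σ)) * D') else 0) := Finset.sum_le_sum hterm
      _ = ∑ n ∈ Finset.Ico M₁ (n₀ + 1), q n + 2 * (freq n₀ ^ (-(2 * σ)) * D') := by
        rw [Finset.sum_add_distrib, ← Finset.sum_filter]
        congr 1
        · refine Finset.sum_congr ?_ fun _ _ => rfl
          ext n; simp [and_comm]
        · simp
      _ < δ / 2 + δ / 2 :=
        add_lt_add ((sum_Ico_le_tsum_tail hq0 hq le_rfl).trans_lt hM₁) hn₀
      _ = δ := add_halves δ
  · rw [Finset.sum_range_succ, ← Finset.sum_range_add_sum_Ico _ hKn₀,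
      ← Finset.sum_range_add_sum_Ico _ hMK]
    have s1 : ∑ n ∈ Finset.range M₁, 2 / freq n ^ 2 * (‖c n‖ ^ 2 - 1) = x - D := by
      rw [hD, sub_sub_cancel]
      exact Finset.sum_congr rfl fun n hn => by rw [c1 n (Finset.mem_range.1 hn)]
    have s2 : ∑ n ∈ Finset.Ico M₁ K, 2 / freq n ^ 2 * (‖c n‖ ^ 2 - 1) = D - D' := by
      rw [hD', sub_add_cancel_left, ← Finset.sum_neg_distrib]
      refine Finset.sum_congr rfl fun n hn => ?_
      rw [c2 n (Finset.mem_Ico.1 hn).1 (Finset.mem_Ico.1 hn).2]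
      simp
    have s3 : ∑ n ∈ Finset.Ico K n₀, 2 / freq n ^ 2 * (‖c n‖ ^ 2 - 1) = 0 := by
      refine Finset.sum_eq_zero fun n hn => ?_
      rw [c3 n (Finset.mem_Ico.1 hn).1 (Finset.mem_Ico.1 hn).2]
      simp
    have s4 : 2 / freq n₀ ^ 2 * (‖c n₀‖ ^ 2 - 1) = D' := by
      rw [c4, hnr, add_sub_cancel_left, mul_div_cancel₀ _ (hw n₀).ne']
    rw [s1, s2, s3, s4]; ring

theorem summable_normWeight_sub {σ : ℝ} {b g : ℕ → ℂ}
    (hb : Summable fun n => normWeight σ n * ‖b n‖ ^ 2)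
    (hg : Summable fun n => normWeight σ n * ‖g n‖ ^ 2) :
    Summable fun n => normWeight σ n * ‖g n - b n‖ ^ 2 := by
  refine Summable.of_nonneg_of_le (fun n => mul_nonneg (normWeight_nonneg σ n) (sq_nonneg _))
    (fun n => ?_) ((hg.add hb).mul_left 2)
  have hbd : ‖g n - b n‖ ^ 2 ≤ 2 * (‖g n‖ ^ 2 + ‖b n‖ ^ 2) := by
    have := pow_le_pow_left₀ (norm_nonneg _) (norm_sub_le (g n) (b n)) 2
    nlinarith [sq_nonneg (‖g n‖ - ‖b n‖)]
  calc _ ≤ normWeight σ n * (2 * (‖g n‖ ^ 2 + ‖b n‖ ^ 2)) :=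
        mul_le_mul_of_nonneg_left hbd (normWeight_nonneg σ n)
    _ = _ := by ring

/-- Markov's inequality, in the form in which it discards an exceptional set. -/
theorem gaussianSeq_ge_le_quarter {F : (ℕ → ℂ) → ℝ} (hF : Measurable F) {t : ℝ} (ht : 0 < t)
    (h : ∫⁻ g, ENNReal.ofReal (F g) ∂gaussianSeq ≤ ENNReal.ofReal (t / 4)) :
    gaussianSeq {g | t ≤ F g} ≤ 1 / 4 := by
  have h0 : ENNReal.ofReal t ≠ 0 := (ENNReal.ofReal_pos.2 ht).ne'
  have h1 := meas_ge_le_lintegral_div (μ := gaussianSeq) hF.ennreal_ofReal.aemeasurable h0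
    ENNReal.ofReal_ne_top
  have h2 : {g | t ≤ F g} ⊆ {g | ENNReal.ofReal t ≤ ENNReal.ofReal (F g)} :=
    fun g hg => ENNReal.ofReal_le_ofReal hg
  refine (measure_mono h2).trans (h1.trans ((ENNReal.div_le_div_right h _).trans_eq ?_))
  rw [ENNReal.ofReal_div_of_pos (by norm_num), ENNReal.div_eq_inv_mul, ENNReal.div_eq_inv_mul,
    mul_left_comm, ENNReal.inv_mul_cancel h0 ENNReal.ofReal_ne_top]
  simp

theorem lintegral_block_norm_le {σ : ℝ} (b : ℕ → ℂ) (s : Finset ℕ) :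
    ∫⁻ g, ENNReal.ofReal (∑ n ∈ s, normWeight σ n * ‖g n - b n‖ ^ 2) ∂gaussianSeq ≤
      ENNReal.ofReal (∑ n ∈ s, normWeight σ n * (1 + ‖b n‖ ^ 2)) := by
  have hW := normWeight_nonneg σ
  have h1 : ∀ g : ℕ → ℂ, ENNReal.ofReal (∑ n ∈ s, normWeight σ n * ‖g n - b n‖ ^ 2) =
      ∑ n ∈ s, ENNReal.ofReal (normWeight σ n * ‖g n - b n‖ ^ 2) := fun g =>
    ENNReal.ofReal_sum_of_nonneg fun n _ => mul_nonneg (hW n) (sq_nonneg _)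
  simp_rw [h1]
  rw [lintegral_finsetSum _ fun n _ => by fun_prop,
    ENNReal.ofReal_sum_of_nonneg fun n _ => mul_nonneg (hW n) (by positivity)]
  refine Finset.sum_le_sum fun n _ => ?_
  rw [lintegral_eval_gaussianSeq n
    (f := fun z => ENNReal.ofReal (normWeight σ n * ‖z - b n‖ ^ 2)) (by fun_prop)]
  simp_rw [ENNReal.ofReal_mul (hW n)]
  rw [lintegral_const_mul _ (by fun_prop)]
  gcongr
  have h := lintegral_norm_add_sq_le (-b n) 1
  simp only [Complex.ofReal_one, one_mul, norm_neg, one_pow, neg_add_eq_sub] at h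
  rwa [add_comm]

/-- The renormalised mass and the position in `ℋ^{-σ}` are simultaneously arbitrary, with positive
probability. -/
theorem gaussianSeq_pos_near {σ : ℝ} (hσ : 0 < σ) {b : ℕ → ℂ}
    (hb : Summable fun n => normWeight σ n * ‖b n‖ ^ 2) {X : (ℕ → ℂ) → ℝ}
    (hX : TendstoInMeasure gaussianSeq (fun N => blockMass (Finset.range N)) atTop X) (x : ℝ)
    {ε δ : ℝ} (hε : 0 < ε) (hδ : 0 < δ) :
    0 < gaussianSeq {g | |X g - x| < ε ∧ ∑' n, normWeight σ n * ‖g n - b n‖ ^ 2 < δ} := by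
  have hW := normWeight_nonneg σ
  set η := min (ε / 3) (δ / 6) with hη
  have hη0 : 0 < η := lt_min (by positivity) (by positivity)
  have hη1 : 3 * η ≤ ε := by linarith [min_le_left (ε / 3) (δ / 6)]
  have hη2 : 3 * η ≤ δ / 2 := by linarith [min_le_right (ε / 3) (δ / 6)]
  let v : ℕ → ℝ := fun n => (2 / freq n ^ 2) ^ 2
  let q : ℕ → ℝ := fun n => normWeight σ n * (1 + ‖b n‖ ^ 2)
  have hq0 : ∀ n, 0 ≤ q n := fun n => mul_nonneg (hW n) (by positivity)
  have hq : Summable q := ((summable_normWeight hσ).add hb).congr fun n => by ring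
  obtain ⟨M₀, hM1, hM2⟩ := (((tendsto_sum_nat_add v).eventually
    (ge_mem_nhds (show 0 < η ^ 2 / 4 by positivity))).and ((tendsto_sum_nat_add q).eventually
    (ge_mem_nhds (show 0 < η / 4 by positivity)))).exists
  obtain ⟨M, hM, c, hc1, hc2⟩ := exists_profile hσ hb (half_pos hδ) x M₀
  have hY : TendstoInMeasure gaussianSeq
      (fun N g => ∑ n ∈ Finset.range N, normWeight σ n * ‖g n - b n‖ ^ 2) atTop
      fun g => ∑' n, normWeight σ n * ‖g n - b n‖ ^ 2 := by
    refine tendstoInMeasure_of_tendsto_ae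
      (fun N => Measurable.aestronglyMeasurable (by fun_prop)) ?_
    filter_upwards [ae_summable_mul_norm_sq hW (summable_normWeight hσ)] with g hg
    exact (summable_normWeight_sub hb hg).hasSum.tendsto_sum_nat
  have key := gaussianSeq_pos_of_blocks (f := fun n z => 2 / freq n ^ 2 * (‖z‖ ^ 2 - 1))
    (h := fun n z => normWeight σ n * ‖z - b n‖ ^ 2) (fun n => by fun_prop) (fun n => by fun_prop)
    hX hY M c hη0 fun N => by
      have e1 : gaussianSeq {g | η ^ 2 ≤ blockMass (Finset.Ico M N) g ^ 2} ≤ 1 / 4 := by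
        refine gaussianSeq_ge_le_quarter ((measurable_blockMass _).pow_const 2) (by positivity) ?_
        rw [lintegral_blockMass_sq]
        exact ENNReal.ofReal_le_ofReal ((sum_Ico_le_tsum_tail (fun n => sq_nonneg _)
          summable_variance hM).trans hM1)
      have e2 : gaussianSeq {g | η ≤ ∑ n ∈ Finset.Ico M N, normWeight σ n * ‖g n - b n‖ ^ 2} ≤
          1 / 4 := by
        refine gaussianSeq_ge_le_quarter (by fun_prop) hη0
          ((lintegral_block_norm_le b _).trans ?_)
        exact ENNReal.ofReal_le_ofReal ((sum_Ico_le_tsum_tail hq0 hq hM).trans hM2)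
      -- Both block sums are small off two sets of measure at most one quarter.
      have hcov : (univ : Set (ℕ → ℂ)) ⊆
          {g | |∑ n ∈ Finset.Ico M N, 2 / freq n ^ 2 * (‖g n‖ ^ 2 - 1)| < η ∧
            |∑ n ∈ Finset.Ico M N, normWeight σ n * ‖g n - b n‖ ^ 2| < η} ∪
          ({g | η ^ 2 ≤ blockMass (Finset.Ico M N) g ^ 2} ∪
            {g | η ≤ ∑ n ∈ Finset.Ico M N, normWeight σ n * ‖g n - b n‖ ^ 2}) := by
        intro g _
        by_cases h1 : η ^ 2 ≤ blockMass (Finset.Ico M N) g ^ 2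
        · exact Or.inr (Or.inl h1)
        by_cases h2 : η ≤ ∑ n ∈ Finset.Ico M N, normWeight σ n * ‖g n - b n‖ ^ 2
        · exact Or.inr (Or.inr h2)
        refine Or.inl ⟨abs_lt_of_sq_lt_sq (not_le.1 h1) hη0.le, ?_⟩
        rw [abs_of_nonneg (Finset.sum_nonneg fun n _ => mul_nonneg (hW n) (sq_nonneg _))]
        exact not_le.1 h2
      have h3 := (measure_mono (μ := gaussianSeq) hcov).trans ((measure_union_le _ _).trans
        (add_le_add le_rfl ((measure_union_le _ _).trans (add_le_add e1 e2))))
      rw [measure_univ] at h3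
      have h4 : (1 : ℝ≥0∞) / 4 + 1 / 4 = 1 / 2 := by
        rw [← ENNReal.add_div]
        rw [ENNReal.div_eq_div_iff (by norm_num) (by norm_num) (by norm_num) (by norm_num)]
        norm_num
      rw [h4] at h3
      have h5 : (1 : ℝ≥0∞) / 2 + 1 / 2 = 1 := ENNReal.add_halves 1
      exact (ENNReal.add_le_add_iff_right (by norm_num)).1 (h5.le.trans h3)
  refine key.trans_le (measure_mono fun g hg => ?_)
  obtain ⟨h1, h2⟩ := hg
  simp only [hc2] at h1
  rw [abs_lt] at h2
  exact ⟨h1.trans_le hη1, by linarith [h2.2]⟩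

/-! ### Supports -/

/-- In every ball of `ℋ^{-σ}`, the limit of the renormalised masses lies in any given interval with
positive probability. -/
theorem freeMeasure_pos_near {σ : ℝ} (hσ : 0 < σ) {X : HSpace (-σ) → ℝ} (hXm : Measurable X)
    (hX : TendstoInMeasure (freeMeasure σ) (fun N => renormMass N) atTop X) (u : HSpace (-σ))
    {r : ℝ} (hr : 0 < r) (x : ℝ) {ε : ℝ} (hε : 0 < ε) :
    0 < freeMeasure σ ({v | |X v - x| < ε} ∩ Metric.ball u r) := by
  have hφ := aemeasurable_randomElement hσ
  have hX1 : TendstoInMeasure gaussianSeq (fun N g => renormMass N (randomElement (-σ) g)) atTop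
      fun g => X (randomElement (-σ) g) := by
    intro t ht
    refine (hX t ht).congr fun N => ?_
    rw [freeMeasure, Measure.map_apply_of_aemeasurable hφ]
    · rfl
    · exact measurableSet_le measurable_const ((measurable_renormMass N).edist hXm)
  have hX2 : TendstoInMeasure gaussianSeq (fun N => blockMass (Finset.range N)) atTop
      fun g => X (randomElement (-σ) g) := by
    have hX3 : TendstoInMeasure gaussianSeq (fun N => blockMass (Finset.range (N + 1))) atTop
        fun g => X (randomElement (-σ) g) := by
      refine hX1.congr_left fun N => ?_
      filter_upwards [ae_coeff_randomElement hσ] with g hg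
      exact renormMass_eq_blockMass hg N
    intro t ht
    exact (tendsto_add_atTop_iff_nat 1).1 (hX3 t ht)
  -- The Gaussian coordinates of `u`.
  let b : ℕ → ℂ := fun n => ((√2 / freq n : ℝ) : ℂ)⁻¹ * coeff u.toDistr n
  have hne : ∀ n, ((√2 / freq n : ℝ) : ℂ) ≠ 0 := fun n => by
    have := freq_pos n
    exact_mod_cast (by positivity : √2 / freq n ≠ 0)
  have hbu : ∀ n, coeff u.toDistr n = ((√2 / freq n : ℝ) : ℂ) * b n := fun n => by
    simp only [b]
    rw [mul_inv_cancel_left₀ (hne n)]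
  have hb : Summable fun n => normWeight σ n * ‖b n‖ ^ 2 := by
    have hu : Summable fun n => freq n ^ (2 * -σ) * ‖coeff u.toDistr n‖ ^ 2 := u.2
    refine hu.congr fun n => ?_
    rw [hbu, weighted_norm_sq_eq]
  have hpos := gaussianSeq_pos_near hσ hb hX2 x hε (sq_pos_of_pos hr)
  have hmeas : MeasurableSet ({v | |X v - x| < ε} ∩ Metric.ball u r) :=
    (measurableSet_lt (by fun_prop) measurable_const).inter Metric.isOpen_ball.measurableSet
  rw [freeMeasure, Measure.map_apply_of_aemeasurable hφ hmeas]
  refine hpos.trans_le (measure_mono_ae ?_)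
  filter_upwards [ae_coeff_randomElement hσ] with g hg h
  obtain ⟨h1, h2⟩ := h
  refine ⟨h1, ?_⟩
  rw [Metric.mem_ball, dist_eq_norm]
  refine lt_of_pow_lt_pow_left₀ 2 hr.le ?_
  rw [HSpace.norm_sq]
  refine (tsum_congr fun n => ?_).trans_lt h2
  have h3 : coeff (randomElement (-σ) g - u).toDistr n =
      coeff (randomElement (-σ) g).toDistr n - coeff u.toDistr n := rfl
  rw [h3, hg, hbu, ← mul_sub, weighted_norm_sq_eq]

theorem exists_ne_zero_mem_cutoffs : ∃ ζ ∈ cutoffs, ζ ≠ 0 := by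
  let f : ContDiffBump (0 : ℝ) := default
  refine ⟨f, ⟨f.contDiff, f.hasCompactSupport, fun x => f.nonneg⟩, fun h => ?_⟩
  have h1 : f 0 = 1 := f.one_of_mem_closedBall (Metric.mem_closedBall_self f.rIn_pos.le)
  rw [h] at h1
  exact zero_ne_one h1

theorem support_freeMeasure {σ : ℝ} (hσ : 0 < σ) : (freeMeasure σ).support = univ := by
  obtain ⟨X, hXm, hX⟩ := exists_limit_renormMass hσ
  refine eq_univ_of_forall fun u => ?_
  rw [Metric.nhds_basis_ball.mem_measureSupport]
  intro r hr
  exact (freeMeasure_pos_near hσ hXm hX u hr 0 one_pos).trans_le (measure_mono inter_subset_right)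

/-- Every focusing Gibbs measure with a nonzero cut-off has full support. -/
theorem support_gibbsMeasure {σ : ℝ} (hσ : 0 < σ) {χ ζ : ℝ → ℝ} (hζ : ζ ∈ cutoffs) (hζ0 : ζ ≠ 0)
    {X Z : HSpace (-σ) → ℝ} (hXm : Measurable X) (hZm : Measurable Z)
    (hX : TendstoInMeasure (freeMeasure σ) (fun N => renormMass N) atTop X)
    (hG : gibbsDensity σ χ ζ =ᵐ[freeMeasure σ] fun u => ζ (X u) * Real.exp (1 / 4 * Z u ^ 4)) :
    (gibbsMeasure σ χ ζ).support = univ := by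
  have hζc : Continuous ζ := hζ.1.continuous
  obtain ⟨x, hx⟩ := Function.ne_iff.1 hζ0
  have hx0 : 0 < ζ x := (hζ.2.2 x).lt_of_ne' hx
  obtain ⟨ε, hε, hball⟩ := Metric.mem_nhds_iff.1
    (hζc.continuousAt.eventually (lt_mem_nhds hx0))
  have hGm : AEMeasurable (gibbsDensity σ χ ζ) (freeMeasure σ) :=
    (Measurable.aemeasurable (by fun_prop)).congr hG.symm
  refine eq_univ_of_forall fun u => ?_
  rw [Metric.nhds_basis_ball.mem_measureSupport]
  intro r hr
  refine pos_iff_ne_zero.2 fun h0 => ?_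
  rw [gibbsMeasure, withDensity_apply_eq_zero' hGm.ennreal_ofReal] at h0
  have hpos := freeMeasure_pos_near hσ hXm hX u hr x hε
  refine (hpos.trans_le ?_).ne' h0
  refine measure_mono_ae ?_
  filter_upwards [hG] with v hv h
  refine ⟨?_, h.2⟩
  have h1 : 0 < ζ (X v) := hball (by rw [Metric.mem_ball, Real.dist_eq]; exact h.1)
  rw [mem_ofPred_eq, hv]
  exact (ENNReal.ofReal_pos.2 (mul_pos h1 (Real.exp_pos _))).ne'

end HarmonicNLS

theorem mainTheorem4 (σ : ℝ) (hσ : 0 < σ) (χ : ℝ → ℝ) (hχ : ContDiff ℝ ∞ χ)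
    (hχ_supp : tsupport χ ⊆ Ioo (-1) 1) (hχ_one : ∀ x ∈ Icc (-(1 / 2) : ℝ) (1 / 2), χ x = 1) :
    (∀ ζ ∈ HarmonicNLS.cutoffs,
      TendstoInMeasure (HarmonicNLS.freeMeasure σ)
        (fun N => HarmonicNLS.approxDensity χ ζ N) atTop (HarmonicNLS.gibbsDensity σ χ ζ)) ∧
    (⋃ ζ ∈ HarmonicNLS.cutoffs, (HarmonicNLS.gibbsMeasure σ χ ζ).support) =
      (HarmonicNLS.freeMeasure σ).support ∧
    ∀ ζ ∈ HarmonicNLS.cutoffs, ζ ≠ 0 → HarmonicNLS.gibbsMeasure σ χ ζ ≠ 0 := by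
  obtain ⟨X, hXm, hX⟩ := HarmonicNLS.exists_limit_renormMass hσ
  obtain ⟨Z, hZm, hZ⟩ := HarmonicNLS.exists_limit_smoothNorm hχ hχ_supp hχ_one hσ
  have hlim := fun ζ (hζ : ζ ∈ HarmonicNLS.cutoffs) =>
    HarmonicNLS.tendstoInMeasure_approxDensity hχ_supp hσ hζ hX hZ
  have hG : ∀ ζ ∈ HarmonicNLS.cutoffs, TendstoInMeasure (HarmonicNLS.freeMeasure σ)
      (fun N => HarmonicNLS.approxDensity χ ζ N) atTop (HarmonicNLS.gibbsDensity σ χ ζ) :=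
    fun ζ hζ => by
      have hζc : Continuous ζ := hζ.1.continuous
      exact HarmonicNLS.gibbsDensity_spec ⟨_, by fun_prop, hlim ζ hζ⟩
  have hsupp : ∀ ζ ∈ HarmonicNLS.cutoffs, ζ ≠ 0 →
      (HarmonicNLS.gibbsMeasure σ χ ζ).support = univ := fun ζ hζ hζ0 =>
    HarmonicNLS.support_gibbsMeasure hσ hζ hζ0 hXm hZm hX
      (tendstoInMeasure_ae_unique (hG ζ hζ) (hlim ζ hζ))
  refine ⟨hG, ?_, fun ζ hζ hζ0 h0 => ?_⟩
  · rw [HarmonicNLS.support_freeMeasure hσ]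
    obtain ⟨ζ, hζ, hζ0⟩ := HarmonicNLS.exists_ne_zero_mem_cutoffs
    exact eq_univ_of_forall fun u => mem_iUnion₂.2 ⟨ζ, hζ, hsupp ζ hζ hζ0 ▸ mem_univ u⟩
  · have h1 := hsupp ζ hζ hζ0
    rw [h0, Measure.support_zero] at h1
    exact empty_ne_univ h1
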